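/- **Theorem.** For single-valued register automata over the rationals ($\mathrm{RA}_{\mathbb Q}$), the commutativity problem and the equivalence problem are both undecidable. *Definitions.* An $\mathrm{RA}_{\mathbb Q}$ over disjoint finite sets $X=\{x_1,\dots,x_k\}$ of control variables and $Y=\{y_1,\dots,y_l\}$ of data variables is a tuple $\mathcal A=\langle Q,q_0,F,u_0,\delta,\zeta\rangle$, where $Q$ is a finite set of states, $q_0\in Q$ is the initial state, $F\subseteq Q$ is the set of final states, $u_0\in\mathbb Q^{k+l}$ is the initial contents of the variables, $\delta$ is a finite set of transitions $(p,\varphi)\to(q,A,B,b)$, and $\zeta$ assigns to each final state a linear expression $g(x,y)=a\cdot x+a'\cdot y+c$ with $a\in\mathbb Q^k$, $a'\in\mathbb Q^l$, $c\in\mathbb Q$. In a transition, $p,q\in Q$; the guard $\varphi$ is a Boolean combination of atoms $z\le z'$ with $z,z'\in X\cup\{\mathrm{cur}\}$, where $\mathrm{cur}$ stands for the input value currently read; $A$ is a $k\times(k+1)$ 0-1 matrix with exactly one $1$ in each row; $B\in\mathbb Q^{l\times(k+l+1)}$ and $b\in\mathbb Q^l$. In state $p$ with contents $u\in\mathbb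 Q^k$, $v\in\mathbb Q^l$ of the control and data variables, when the value $d\in\mathbb Q$ is read and $\varphi(u,d)$ holds, the automaton may move to state $q$ with the new contents $A\binom{u}{d}$ of the control variables and $B\left(\begin{smallmatrix}u\\ v\\ d\end{smallmatrix}\right)+b$ of the data variables. For a word $w\in\mathbb Q^*$, $\mathcal A(w)\subseteq\mathbb Q$ is the set of all values $\zeta(q)(u,v)$ such that some run on $w$ from $(q_0,u_0)$ ends in a final state $q$ with contents $(u,v)$. $\mathcal A$ is *single-valued* if $|\mathcal A(w)|\le 1$ for every $w\in\mathbb Q^*$. *Problems.* Commutativity: given a single-valued $\mathrm{RA}_{\mathbb Q}$ $\mathcal A$, decide whether $\mathcal A(w)=\mathcal A(w')$ for all words $w$ and all permutations $w'$ of $w$. Equivalence: given two single-valued $\mathrm{RA}_{\mathbb Q}$ $\mathcal A$ and $\mathcal A'$ (possibly with different states and variables), decide whether $\mathcal A(w)=\mathcal A'(w)$ for all words $w$. Automata are given to an algorithm by finite descriptions, and undecidability means that no algorithm halts with the correct answer on all descriptions of single-valued $\mathrm{RA}_{\mathbb Q}$ (respectively, of pairs of them), even if its behaviour on all other inputs is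 arbitrary. -/

import Mathlib

/-! ### Register automata over the rationals -/

/-- Linear constraints over a set `V` of variables: Boolean combinations of atoms `z ≤ z'`.
(A guard that is always true is `le z z`.) -/
inductive Guard (V : Type) : Type
  | le (z z' : V) : Guard V
  | neg (φ : Guard V) : Guard V
  | and (φ ψ : Guard V) : Guard V
  | or (φ ψ : Guard V) : Guard V

namespace Guard

/-- Truth of a linear constraint under a valuation of the variables by rationals. -/
def Holds {V : Type} (ν : V → ℚ) : Guard V → Prop
  | le z z' => ν z ≤ ν z'
  | neg φ => ¬ Holds ν φ
  | and φ ψ => Holds ν φ ∧ Holds ν ψ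
  | or φ ψ => Holds ν φ ∨ Holds ν ψ

/-- Renaming of variables. -/
def map {V W : Type} (f : V → W) : Guard V → Guard W
  | le z z' => le (f z) (f z')
  | neg φ => neg (map f φ)
  | and φ ψ => and (map f φ) (map f ψ)
  | or φ ψ => or (map f φ) (map f ψ)

end Guard

/-- A transition `(p, φ(x, cur)) → (q, A, B, b)` over control variables `X` and data variables `Y`.
In `Option X`, `none` is the special variable `cur` and `some x` is the control variable `x`.
The 0-1 matrix `A` with exactly one `1` in each row is given as the map that sends each control
variable to the element of `X ∪ {cur}` whose value it receives. The columns of `B` are indexed by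
`X`, then `Y`, then `cur`. -/
structure RAQTransition (Q X Y : Type) : Type where
  src : Q
  guard : Guard (Option X)
  tgt : Q
  ctrl : X → Option X
  dataMat : Matrix Y (X ⊕ (Y ⊕ Unit)) ℚ
  dataVec : Y → ℚ

/-- A linear expression `a · x + b · y + c`. -/
structure RAQOutput (X Y : Type) : Type where
  ctrlCoeff : X → ℚ
  dataCoeff : Y → ℚ
  const : ℚ

/-- A register automaton over the rationals with states `Q`, control variables `X` and data
variables `Y`. Only the values of `out` on final states are ever used. -/
structure RAQ (Q X Y : Type) : Type where
  start : Q
  final : Set Q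
  initCtrl : X → ℚ
  initData : Y → ℚ
  trans : Set (RAQTransition Q X Y)
  finite_trans : trans.Finite
  out : Q → RAQOutput X Y

/-- A configuration: a state and the contents of the control and the data variables. -/
structure RAQConfig (Q X Y : Type) : Type where
  state : Q
  ctrl : X → ℚ
  data : Y → ℚ

/-- The valuation of `X ∪ {cur}` given by contents `u` of `X` and the current value `d`. -/
def curVal {X : Type} (u : X → ℚ) (d : ℚ) : Option X → ℚ
  | none => d
  | some x => u x

/-- The relation `c ⊢_{t,d} c'`. -/
def RAQTransition.Entails {Q X Y : Type} [Fintype X] [Fintype Y] (t : RAQTransition Q X Y) (d : ℚ)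
    (c c' : RAQConfig Q X Y) : Prop :=
  c.state = t.src ∧ c'.state = t.tgt ∧ t.guard.Holds (curVal c.ctrl d) ∧
    (∀ x, c'.ctrl x = curVal c.ctrl d (t.ctrl x)) ∧
    c'.data = t.dataMat.mulVec (Sum.elim c.ctrl (Sum.elim c.data fun _ => d)) + t.dataVec

/-- The value of a linear expression. -/
def RAQOutput.eval {X Y : Type} [Fintype X] [Fintype Y] (g : RAQOutput X Y)
    (u : X → ℚ) (v : Y → ℚ) : ℚ :=
  g.ctrlCoeff ⬝ᵥ u + g.dataCoeff ⬝ᵥ v + g.const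

namespace RAQ

variable {Q Q' X X' Y Y' : Type} [Fintype X] [Fintype Y] [Fintype X'] [Fintype Y']

/-- The initial configuration. -/
def initConfig (𝒜 : RAQ Q X Y) : RAQConfig Q X Y :=
  ⟨𝒜.start, 𝒜.initCtrl, 𝒜.initData⟩

/-- There is a run of `𝒜` that reads the word and leads from the first to the second
configuration. -/
def Reaches (𝒜 : RAQ Q X Y) : List ℚ → RAQConfig Q X Y → RAQConfig Q X Y → Prop
  | [], c, c' => c = c'
  | d :: w, c, c' => ∃ c₁, (∃ t ∈ 𝒜.trans, t.Entails d c c₁) ∧ Reaches 𝒜 w c₁ c'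

/-- `𝒜(w)`: the set of all outputs of accepting runs of `𝒜` on `w`. -/
def outputs (𝒜 : RAQ Q X Y) (w : List ℚ) : Set ℚ :=
  {r | ∃ c, 𝒜.Reaches w 𝒜.initConfig c ∧ c.state ∈ 𝒜.final ∧
    r = (𝒜.out c.state).eval c.ctrl c.data}

/-- Every word has at most one output. -/
def SingleValued (𝒜 : RAQ Q X Y) : Prop :=
  ∀ w, (𝒜.outputs w).Subsingleton

/-- The set of outputs is invariant under permutations of the input word. -/
def IsCommutative (𝒜 : RAQ Q X Y) : Prop :=
  ∀ w w' : List ℚ, w'.Perm w → 𝒜.outputs w = 𝒜.outputs w'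

/-- Two automata, possibly with different states and variables, have the same outputs on
every word. -/
def Equivalent (𝒜 : RAQ Q X Y) (ℬ : RAQ Q' X' Y') : Prop :=
  ∀ w, 𝒜.outputs w = ℬ.outputs w

end RAQ

/-! ### Finite descriptions of automata, as inputs of algorithms -/

/-- Gödel numbers of linear constraints whose variables are numbered. -/
def Guard.toNat : Guard ℕ → ℕ
  | .le i j => 4 * Nat.pair i j
  | .neg φ => 4 * φ.toNat + 1
  | .and φ ψ => 4 * Nat.pair φ.toNat ψ.toNat + 2
  | .or φ ψ => 4 * Nat.pair φ.toNat ψ.toNat + 3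

/-- The linear constraint with a given Gödel number. -/
def Guard.ofNat (n : ℕ) : Guard ℕ :=
  if n % 4 = 0 then .le (n / 4).unpair.1 (n / 4).unpair.2
  else if n % 4 = 1 then .neg (Guard.ofNat (n / 4))
  else if n % 4 = 2 then
    .and (Guard.ofNat (n / 4).unpair.1) (Guard.ofNat (n / 4).unpair.2)
  else .or (Guard.ofNat (n / 4).unpair.1) (Guard.ofNat (n / 4).unpair.2)
termination_by n
decreasing_by
  all_goals
    have h₁ := Nat.unpair_left_le (n / 4)
    have h₂ := Nat.unpair_right_le (n / 4)
    omega

theorem Guard.ofNat_toNat (φ : Guard ℕ) : Guard.ofNat φ.toNat = φ := by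
  induction φ with
  | le i j => rw [Guard.ofNat]; simp [Guard.toNat]
  | neg φ ih =>
    rw [Guard.ofNat]
    simp [Guard.toNat, Nat.add_mod, show (4 * φ.toNat + 1) / 4 = φ.toNat by omega, ih]
  | and φ ψ ih₁ ih₂ =>
    rw [Guard.ofNat]
    simp [Guard.toNat, Nat.add_mod,
      show (4 * Nat.pair φ.toNat ψ.toNat + 2) / 4 = Nat.pair φ.toNat ψ.toNat by omega, ih₁, ih₂]
  | or φ ψ ih₁ ih₂ =>
    rw [Guard.ofNat]
    simp [Guard.toNat, Nat.add_mod,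
      show (4 * Nat.pair φ.toNat ψ.toNat + 3) / 4 = Nat.pair φ.toNat ψ.toNat by omega, ih₁, ih₂]

theorem Guard.toNat_ofNat (n : ℕ) : (Guard.ofNat n).toNat = n := by
  induction n using Nat.strong_induction_on with
  | _ n ih =>
    have h₁ := Nat.unpair_left_le (n / 4)
    have h₂ := Nat.unpair_right_le (n / 4)
    rw [Guard.ofNat]
    split_ifs with h h' h''
    · simp only [Guard.toNat, Nat.pair_unpair]; omega
    · simp only [Guard.toNat]; rw [ih _ (by omega)]; omega
    · simp only [Guard.toNat]
      rw [ih _ (by omega), ih _ (by omega), Nat.pair_unpair]; omega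
    · simp only [Guard.toNat]
      rw [ih _ (by omega), ih _ (by omega), Nat.pair_unpair]; omega

/-- Linear constraints with numbered variables correspond bijectively to their Gödel numbers. -/
def Guard.equivNat : Guard ℕ ≃ ℕ :=
  ⟨Guard.toNat, Guard.ofNat, Guard.ofNat_toNat, Guard.toNat_ofNat⟩

instance : Primcodable (Guard ℕ) := Primcodable.ofEquiv ℕ Guard.equivNat

/-- A rational number given by a numerator and the predecessor of a positive denominator. -/
abbrev RatCode : Type := ℤ × ℕ

/-- The rational number `a / (b + 1)` described by `(a, b)`. -/
def RatCode.val (r : RatCode) : ℚ := (r.1 : ℚ) / ((r.2 : ℚ) + 1)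

/-- The `i`-th entry of a list of rationals; missing entries are `0`. -/
def ratEntry (L : List RatCode) (i : ℕ) : ℚ := RatCode.val (L.getD i (0, 0))

/-- Among `k` control variables, `i < k` names the `i`-th one, and any other number names
`cur`. -/
def varOf (k i : ℕ) : Option (Fin k) := if h : i < k then some ⟨i, h⟩ else none

/-- The description of a transition: source, guard, target, the list of the names of the variables
assigned to the control variables, the list of the rows of the matrix for the data variables, and
the vector of constants. -/
structure TransitionCode : Type where
  src : ℕ
  guard : Guard ℕ
  tgt : ℕ
  ctrl : List ℕ
  dataMat : List (List RatCode)
  dataVec : List RatCode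

/-- The tuple of the components of the description of a transition. -/
def TransitionCode.equivProd : TransitionCode ≃
    ℕ × Guard ℕ × ℕ × List ℕ × List (List RatCode) × List RatCode where
  toFun t := (t.src, t.guard, t.tgt, t.ctrl, t.dataMat, t.dataVec)
  invFun p := ⟨p.1, p.2.1, p.2.2.1, p.2.2.2.1, p.2.2.2.2.1, p.2.2.2.2.2⟩
  left_inv _ := rfl
  right_inv _ := rfl

instance : Primcodable TransitionCode := Primcodable.ofEquiv _ TransitionCode.equivProd

/-- The description of an automaton with `numStates + 1` states, `numCtrl` control variables and
`numData` data variables: the initial state, the list of the final states, the initial contents of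
the variables (control variables first), the list of the transitions, and for each state the
coefficients (control variables first) and the constant term of its output expression. -/
structure RAQCode : Type where
  numStates : ℕ
  numCtrl : ℕ
  numData : ℕ
  start : ℕ
  final : List ℕ
  initial : List RatCode
  trans : List TransitionCode
  out : List (List RatCode × RatCode)

/-- The tuple of the components of the description of an automaton. -/
def RAQCode.equivProd : RAQCode ≃
    ℕ × ℕ × ℕ × ℕ × List ℕ × List RatCode × List TransitionCode ×
      List (List RatCode × RatCode) where
  toFun c := (c.numStates, c.numCtrl, c.numData, c.start, c.final, c.initial, c.trans, c.out)
  invFun p := ⟨p.1, p.2.1, p.2.2.1, p.2.2.2.1, p.2.2.2.2.1, p.2.2.2.2.2.1, p.2.2.2.2.2.2.1,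
    p.2.2.2.2.2.2.2⟩
  left_inv _ := rfl
  right_inv _ := rfl

instance : Primcodable RAQCode := Primcodable.ofEquiv _ RAQCode.equivProd

/-- The described transition. Numbers of states are read modulo the number of states; control
variables without an entry keep their value; missing rows, columns and constants are `0`. -/
def TransitionCode.toTransition (n k l : ℕ) (t : TransitionCode) :
    RAQTransition (Fin (n + 1)) (Fin k) (Fin l) where
  src := Fin.ofNat (n + 1) t.src
  guard := t.guard.map (varOf k)
  tgt := Fin.ofNat (n + 1) t.tgt
  ctrl i := varOf k (t.ctrl.getD i i)
  dataMat := Matrix.of fun j => Sum.elim (fun i => ratEntry (t.dataMat.getD j []) i)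
    (Sum.elim (fun j' => ratEntry (t.dataMat.getD j []) (k + j'))
      fun _ => ratEntry (t.dataMat.getD j []) (k + l))
  dataVec j := ratEntry t.dataVec j

/-- The described linear expression. -/
def outputOf (k l : ℕ) (g : List RatCode × RatCode) : RAQOutput (Fin k) (Fin l) where
  ctrlCoeff i := ratEntry g.1 i
  dataCoeff j := ratEntry g.1 (k + j)
  const := RatCode.val g.2

/-- The automaton described by a code. Every code describes an automaton, and every automaton is
described by a code, as `RAQCode.exists_code` shows. -/
def RAQCode.toRAQ (c : RAQCode) : RAQ (Fin (c.numStates + 1)) (Fin c.numCtrl) (Fin c.numData) where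
  start := Fin.ofNat _ c.start
  final := {q | ∃ s ∈ c.final, q = Fin.ofNat _ s}
  initCtrl i := ratEntry c.initial i
  initData j := ratEntry c.initial (c.numCtrl + j)
  trans := {t | ∃ s ∈ c.trans, t = s.toTransition c.numStates c.numCtrl c.numData}
  finite_trans := by
    refine (c.trans.map
      (fun s => s.toTransition c.numStates c.numCtrl c.numData)).finite_toSet.subset ?_
    rintro t ⟨s, hs, rfl⟩
    exact List.mem_map.2 ⟨s, hs, rfl⟩
  out q := outputOf c.numCtrl c.numData (c.out.getD q ([], (0, 0)))

/-! ### Surjectivity of the descriptions -/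

theorem RatCode.exists_val (r : ℚ) : ∃ c : RatCode, c.val = r := by
  refine ⟨(r.num, r.den - 1), ?_⟩
  have h : ((r.den - 1 : ℕ) : ℚ) + 1 = r.den := by
    exact_mod_cast Nat.sub_add_cancel r.pos
  rw [RatCode.val]
  simp only [h]
  exact Rat.num_div_den r

theorem exists_list_entry {α : Type} (m : ℕ) (f : Fin m → α) (a : ℕ → α) :
    ∃ L : List α, ∀ i : Fin m, L.getD i (a i) = f i :=
  ⟨List.ofFn f, fun i => by simp [List.getD_eq_getElem?_getD]⟩

theorem exists_ratEntry (m : ℕ) (f : Fin m → ℚ) :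
    ∃ L : List RatCode, ∀ (i : ℕ) (h : i < m), ratEntry L i = f ⟨i, h⟩ := by
  choose g hg using RatCode.exists_val
  obtain ⟨L, hL⟩ := exists_list_entry m (fun i => g (f i)) (fun _ => (0, 0))
  exact ⟨L, fun i h => by rw [ratEntry, hL ⟨i, h⟩, hg]⟩

theorem exists_varOf {k : ℕ} (z : Option (Fin k)) : ∃ i, varOf k i = z := by
  cases z with
  | none => exact ⟨k, by simp [varOf]⟩
  | some x => exact ⟨x, by simp [varOf]⟩

theorem Guard.exists_map {k : ℕ} (φ : Guard (Option (Fin k))) :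
    ∃ ψ : Guard ℕ, ψ.map (varOf k) = φ := by
  induction φ with
  | le z z' =>
    obtain ⟨i, rfl⟩ := exists_varOf z
    obtain ⟨j, rfl⟩ := exists_varOf z'
    exact ⟨.le i j, rfl⟩
  | neg φ ih => obtain ⟨ψ, rfl⟩ := ih; exact ⟨.neg ψ, rfl⟩
  | and φ φ' ih ih' =>
    obtain ⟨ψ, rfl⟩ := ih; obtain ⟨ψ', rfl⟩ := ih'; exact ⟨.and ψ ψ', rfl⟩
  | or φ φ' ih ih' =>
    obtain ⟨ψ, rfl⟩ := ih; obtain ⟨ψ', rfl⟩ := ih'; exact ⟨.or ψ ψ', rfl⟩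

/-- A list of rationals with prescribed entries for control variables, data variables and `cur`. -/
theorem exists_row {k l : ℕ} (u : Fin k → ℚ) (v : Fin l → ℚ) (d : ℚ) :
    ∃ L : List RatCode, (∀ i : Fin k, ratEntry L i = u i) ∧
      (∀ j : Fin l, ratEntry L (k + j) = v j) ∧ ratEntry L (k + l) = d := by
  obtain ⟨L, hL⟩ := exists_ratEntry (k + l + 1)
    (fun i => if h : (i : ℕ) < k then u ⟨i, h⟩
      else if h' : (i : ℕ) - k < l then v ⟨i - k, h'⟩ else d)
  refine ⟨L, fun i => ?_, fun j => ?_, ?_⟩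
  · rw [hL _ (by omega)]; simp
  · rw [hL _ (by omega)]; simp
  · rw [hL _ (by omega)]; simp

theorem TransitionCode.exists_code {n k l : ℕ} (t : RAQTransition (Fin (n + 1)) (Fin k) (Fin l)) :
    ∃ s : TransitionCode, s.toTransition n k l = t := by
  obtain ⟨p, φ, q, A, B, b⟩ := t
  obtain ⟨ψ, rfl⟩ := φ.exists_map
  choose a ha using fun i => exists_varOf (A i)
  obtain ⟨LA, hA⟩ := exists_list_entry k a id
  choose R hR using fun j => exists_row (fun i => B j (.inl i)) (fun i => B j (.inr (.inl i)))
    (B j (.inr (.inr ())))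
  obtain ⟨LB, hB⟩ := exists_list_entry l R (fun _ => [])
  obtain ⟨Lb, hb⟩ := exists_ratEntry l b
  refine ⟨⟨p, ψ, q, LA, LB, Lb⟩, ?_⟩
  rw [TransitionCode.toTransition, RAQTransition.mk.injEq]
  refine ⟨by simp, rfl, by simp, ?_, ?_, ?_⟩
  · funext i
    have := hA i
    simp only [id] at this
    rw [this, ha]
  · funext j c
    rw [Matrix.of_apply, hB j]
    rcases c with i | i | i
    · exact (hR j).1 i
    · exact (hR j).2.1 i
    · exact (hR j).2.2
  · funext j; exact hb j j.2

theorem RAQCode.exists_code {n k l : ℕ} (𝒜 : RAQ (Fin (n + 1)) (Fin k) (Fin l)) :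
    ∃ (s : ℕ) (F : List ℕ) (u : List RatCode) (T : List TransitionCode)
      (o : List (List RatCode × RatCode)), (RAQCode.mk n k l s F u T o).toRAQ = 𝒜 := by
  classical
  obtain ⟨q, F, u, v, T, hT, o⟩ := 𝒜
  obtain ⟨Lu, hu, hv, -⟩ := exists_row u v 0
  choose c hc using fun t => TransitionCode.exists_code (n := n) (k := k) (l := l) t
  choose r hr using RatCode.exists_val
  choose R hR hR' _ using fun p : Fin (n + 1) => exists_row (o p).ctrlCoeff (o p).dataCoeff 0
  obtain ⟨Lo, hLo⟩ := exists_list_entry (n + 1) (fun p => (R p, r (o p).const))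
    (fun _ => ([], (0, 0)))
  refine ⟨q, (Finset.univ.filter (· ∈ F)).toList.map Fin.val, Lu, hT.toFinset.toList.map c, Lo, ?_⟩
  simp only [RAQCode.toRAQ, RAQ.mk.injEq]
  refine ⟨by simp, ?_, funext hu, funext hv, ?_, ?_⟩
  · ext p; simp
  · ext t; simp [hc]
  · funext p
    rw [hLo p]
    simp only [outputOf, hR, hR', hr]

/-! ### Decidability -/

/-- The decision problem "given an instance `a`, decide whether `P a`", where the instances are the
elements of `α` that satisfy `I`, is decidable: some algorithm halts with the correct answer on
every instance (its behaviour on the other elements of `α` is arbitrary). -/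
def DecidableProblem {α : Type} [Primcodable α] (I P : α → Prop) : Prop :=
  ∃ f : α →. Bool, Partrec f ∧ ∀ a, I a → ∃ b ∈ f a, (b = true ↔ P a)

/-!
The halting problem of a fixed Turing machine, whose inputs are tapes `a₀ a₁ b ⋯ b` with `n` copies
of `b`, is reduced to both problems. The automaton `UnaryMachine.code n` outputs `0` on every word
that does not encode a halting computation on the input with number `n`, and has no output on the
words that do.

A word is read as a sequence of cells, each of which consists of a key and a letter for a symbol. A
computation is written as a sequence of rows of the same length, one for each configuration, and
each row starts with a border symbol. All rows carry the same keys, which are strictly increasing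
within a row. So the cell below a given one, in the next row, is the next cell with the same key,
and its symbol is determined by the given cell and its two neighbours. The rows are thus wound up to
a helix, and all the conditions on a history, collected in `UnaryMachine.IsHelix`, are local in the
following sense: a nondeterministic automaton can guess the place of a violation, store one or two
keys, and confirm the violation. Only the check of the first row depends on `n`; it uses
a chain of `2 * n` states that count letters, so that the reduction is primitive recursive.

That a history exists if and only if the machine halts is shown in `UnaryMachine.IsHelix.halts` and
`UnaryMachine.Halts.exists_isHelix`. That the automaton accepts exactly the words that are no
histories is shown in `UnaryMachine.IsHelix.not_accepts`, where an invariant is attached to every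
state, and in `UnaryMachine.exists_isHelix_of_not_accepts`.

If the machine does not halt, the automaton outputs `0` on every word; hence it is commutative, and
equivalent to a trivial automaton. If the machine halts, there is a word without output; it becomes
a word with output `0` if its first two letters, a key and a symbol, are interchanged, so that the
automaton is neither commutative nor equivalent to the trivial one. The undecidable halting problem
comes from Mathlib's compilation of partial recursive functions to Turing machines. It provides the
input as a binary number, and `2 ^ n` in binary is essentially `n` in unary.
-/

/-! ### A Turing machine with undecidable halting problem -/

open Turing

/-- A configuration of a Turing machine with states `Λ` and tape symbols `Γ` whose cells have fixed
addresses in `ℤ`: the state, the position of the head and the contents of the tape. -/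
structure TapeCfg (Λ Γ : Type) : Type where
  state : Λ
  pos : ℤ
  tape : ℤ → Γ

namespace TapeCfg

variable {Λ Γ : Type}

/-- The effect of an instruction. -/
def exec (c : TapeCfg Λ Γ) : Λ × TM0.Stmt Γ → TapeCfg Λ Γ
  | (q, .move .left) => ⟨q, c.pos - 1, c.tape⟩
  | (q, .move .right) => ⟨q, c.pos + 1, c.tape⟩
  | (q, .write a) => ⟨q, c.pos, Function.update c.tape c.pos a⟩

/-- One step of the machine `M`; halted configurations do not change. -/
def step (M : Λ → Γ → Option (Λ × TM0.Stmt Γ)) (c : TapeCfg Λ Γ) : TapeCfg Λ Γ :=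
  ((M c.state (c.tape c.pos)).map c.exec).getD c

/-- The machine `M` has no instruction for this configuration. -/
def Halted (M : Λ → Γ → Option (Λ × TM0.Stmt Γ)) (c : TapeCfg Λ Γ) : Prop :=
  M c.state (c.tape c.pos) = none

end TapeCfg

/-- The machine `M` halts when started in state `q` at cell `0` of the given tape. -/
def HaltsOn {Λ Γ : Type} (M : Λ → Γ → Option (Λ × TM0.Stmt Γ)) (q : Λ) (f : ℤ → Γ) : Prop :=
  ∃ t, ((TapeCfg.step M)^[t] ⟨q, 0, f⟩).Halted M

/-- The tape that carries `a₀ a₁ b ⋯ b`, with `n` copies of `b`, from cell `0` on, and blanks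
elsewhere. -/
def inputTape {Γ : Type} (blank a₀ a₁ b : Γ) (n : ℕ) (i : ℤ) : Γ :=
  if i = 0 then a₀ else if i = 1 then a₁ else if 2 ≤ i ∧ i < n + 2 then b else blank

section TM0

variable {Λ Γ : Type} [Inhabited Λ] [Inhabited Γ]

/-- Configurations of `Turing.TM0` correspond to configurations with absolute addresses. -/
def TapeMatches {S : Set Λ} (c : TM0.Cfg Γ Λ) (d : TapeCfg S Γ) : Prop :=
  c.q = d.state ∧ ∀ i, c.Tape.nth i = d.tape (d.pos + i)

/-- The restriction of a machine to a set of states that is closed under its steps. -/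
def restrictMachine (M : TM0.Machine Γ Λ) {S : Set Λ} (hS : TM0.Supports M S) (q : S) (a : Γ) :
    Option (S × TM0.Stmt Γ) :=
  match h : M q a with
  | none => none
  | some (q', s) => some (⟨q', hS.2 (Option.mem_def.2 h) q.2⟩, s)

omit [Inhabited Γ] in
theorem restrictMachine_eq_none (M : TM0.Machine Γ Λ) {S : Set Λ} (hS : TM0.Supports M S) (q : S)
    (a : Γ) : restrictMachine M hS q a = none ↔ M q a = none := by
  unfold restrictMachine
  split <;> simp_all

theorem TapeMatches.step {M : TM0.Machine Γ Λ} {S : Set Λ} {hS : TM0.Supports M S}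
    {c c' : TM0.Cfg Γ Λ} {d : TapeCfg S Γ} (h : TapeMatches c d) (hc : TM0.step M c = some c') :
    TapeMatches c' (d.step (restrictMachine M hS)) := by
  obtain ⟨q, T⟩ := c
  obtain ⟨p, x, f⟩ := d
  obtain ⟨h₁, h₂⟩ := h
  simp only at h₁ h₂
  subst h₁
  have h0 : T.1 = f x := by simpa using h₂ 0
  rw [TM0.step, Option.map_eq_some_iff] at hc
  obtain ⟨⟨q', s⟩, hM, rfl⟩ := hc
  have hR : restrictMachine M hS p (f x)
      = some (⟨q', hS.2 (Option.mem_def.2 hM) p.2⟩, s) := by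
    have hM' : M p (f x) = some (q', s) := h0 ▸ hM
    unfold restrictMachine
    split
    · next h₁ => exact absurd (hM'.symm.trans h₁) (by simp)
    · next q₁ s₁ h₁ =>
      obtain ⟨rfl, rfl⟩ := Prod.mk.inj (Option.some.inj (hM'.symm.trans h₁))
      rfl
  simp only [TapeCfg.step, hR, Option.map_some, Option.getD_some]
  rcases s with (_ | _) | a
  · refine ⟨rfl, fun i => ?_⟩
    simp only [TapeCfg.exec, Tape.move_left_nth, h₂]
    congr 1; ring
  · refine ⟨rfl, fun i => ?_⟩
    simp only [TapeCfg.exec, Tape.move_right_nth, h₂]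
    congr 1; ring
  · refine ⟨rfl, fun i => ?_⟩
    simp only [TapeCfg.exec, Tape.write_nth, h₂, Function.update_apply, add_eq_left]

theorem TapeMatches.halted_iff {M : TM0.Machine Γ Λ} {S : Set Λ} {hS : TM0.Supports M S}
    {c : TM0.Cfg Γ Λ} {d : TapeCfg S Γ} (h : TapeMatches c d) :
    d.Halted (restrictMachine M hS) ↔ TM0.step M c = none := by
  obtain ⟨q, T⟩ := c
  obtain ⟨p, x, f⟩ := d
  obtain ⟨h₁, h₂⟩ := h
  simp only at h₁ h₂
  subst h₁
  have h0 : T.1 = f x := by simpa using h₂ 0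
  simp [TapeCfg.Halted, restrictMachine_eq_none, TM0.step, h0]

theorem TapeMatches.haltsOn_iff {M : TM0.Machine Γ Λ} {S : Set Λ} (hS : TM0.Supports M S)
    {c : TM0.Cfg Γ Λ} {d : TapeCfg S Γ} (h : TapeMatches c d) :
    (∃ t, ((TapeCfg.step (restrictMachine M hS))^[t] d).Halted (restrictMachine M hS)) ↔
      (StateTransition.eval (TM0.step M) c).Dom := by
  constructor
  · rintro ⟨t, ht⟩
    induction t generalizing c d with
    | zero =>
      refine Part.dom_iff_mem.2 ⟨c, StateTransition.mem_eval.2 ⟨.refl, h.halted_iff.1 ht⟩⟩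
    | succ t ih =>
      cases hc : TM0.step M c with
      | none => exact Part.dom_iff_mem.2 ⟨c, StateTransition.mem_eval.2 ⟨.refl, hc⟩⟩
      | some c' =>
        rw [StateTransition.reaches_eval (Relation.ReflTransGen.single hc)]
        exact ih (h.step hc) ht
  · intro hd
    obtain ⟨e, he⟩ := Part.dom_iff_mem.1 hd
    obtain ⟨hr, he⟩ := StateTransition.mem_eval.1 he
    clear hd
    rename_i he'
    clear he'
    induction hr using Relation.ReflTransGen.head_induction_on generalizing d with
    | refl => exact ⟨0, h.halted_iff.2 he⟩
    | head h₁ _ ih =>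
      obtain ⟨t, ht⟩ := ih (h.step (hS := hS) h₁)
      exact ⟨t + 1, ht⟩

theorem haltsOn_restrictMachine_iff {M : TM0.Machine Γ Λ} {S : Set Λ} (hS : TM0.Supports M S)
    (a₀ a₁ b : Γ) (n : ℕ) :
    HaltsOn (restrictMachine M hS) ⟨default, hS.1⟩ (inputTape default a₀ a₁ b n) ↔
      (TM0.eval M (a₀ :: a₁ :: List.replicate n b)).Dom := by
  refine (TapeMatches.haltsOn_iff hS (c := TM0.init (a₀ :: a₁ :: List.replicate n b)) ?_)
  refine ⟨rfl, fun i => ?_⟩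
  rw [zero_add]
  rcases i with i | i
  · rw [Int.ofNat_eq_natCast, ← Tape.right₀_nth]
    simp only [TM0.init, Tape.mk₁, Tape.mk₂, Tape.mk'_right₀, ListBlank.nth_mk]
    rcases i with _ | _ | i
    · simp [inputTape]
    · simp [inputTape]
    · simp only [inputTape, List.getI_cons_succ]
      rw [if_neg (by omega), if_neg (by omega), List.getI_eq_getElem?_getD,
        List.getElem?_replicate]
      by_cases hi : i < n
      · rw [if_pos hi, if_pos (by omega), Option.getD_some]
      · rw [if_neg hi, if_neg (by omega), Option.getD_none]
  · have : inputTape default a₀ a₁ b n (Int.negSucc i) = default := by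
      unfold inputTape
      rw [if_neg (by omega), if_neg (by omega), if_neg (by omega)]
    refine Eq.trans ?_ this.symm
    simp only [Tape.nth, TM0.init, Tape.mk₁, Tape.mk₂, Tape.mk'_left]
    simp [ListBlank.nth_mk, List.getI]

end TM0

open PartrecToTM2 in
theorem trNat_two_pow (n : ℕ) : trNat (2 ^ n) = List.replicate n Γ'.bit0 ++ [Γ'.bit1] := by
  induction n with
  | zero => rfl
  | succ n ih =>
    have h : ((2 ^ (n + 1) : ℕ) : Num) = Num.bit0 ((2 ^ n : ℕ) : Num) := by
      rw [pow_succ, mul_two, Nat.cast_add, Num.bit0_of_bit0]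
    rw [trNat, h, List.replicate_succ, List.cons_append, ← ih, trNat]
    cases hm : ((2 ^ n : ℕ) : Num) with
    | zero =>
      have := Num.to_of_nat (2 ^ n)
      rw [hm] at this
      exact absurd this (pow_pos two_pos n).ne
    | pos m => rfl

/-- A stack machine with finitely many reachable labels is simulated by a finite Turing machine,
which receives the stack contents in reversed order. -/
theorem exists_machine_haltsOn_iff_TM2 {K Γ Λ σ : Type} [DecidableEq K] [Fintype K] [Fintype Γ]
    [Fintype σ] [Inhabited Λ] [Inhabited σ] (M : Λ → TM2.Stmt (fun _ : K => Γ) Λ σ)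
    (S : Finset Λ) (hS : TM2.Supports M S) (k : K) (x y z : Γ) :
    ∃ (Λ' Γ' : Type) (_ : Fintype Λ') (_ : Fintype Γ') (M' : Λ' → Γ' → Option (Λ' × TM0.Stmt Γ'))
      (q₀ : Λ') (blank a₀ a₁ b : Γ'), ∀ n, HaltsOn M' q₀ (inputTape blank a₀ a₁ b n) ↔
        (TM2.eval M k (List.replicate n z ++ [y, x])).Dom := by
  have hs := TM1to0.tr_supports _ (TM2to1.tr_supports _ hS)
  let e : Γ → ∀ _ : K, Option Γ := fun a => Function.update (fun _ => none) k (some a)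
  refine ⟨_, TM2to1.Γ' K (fun _ => Γ), inferInstance, TM2to1.Γ'.fintype, restrictMachine _ hs,
    ⟨default, hs.1⟩, default, (true, e x), (false, e y), (false, e z), fun n => ?_⟩
  refine (haltsOn_restrictMachine_iff hs _ _ _ n).trans ?_
  rw [TM1to0.tr_eval, ← TM2to1.tr_eval_dom]
  have : TM2to1.trInit (K := K) (Γ := fun _ => Γ) k (List.replicate n z ++ [y, x]) =
      (true, e x) :: (false, e y) :: List.replicate n (false, e z) := by
    have hr : (List.replicate n z ++ [y, x]).reverse = x :: y :: List.replicate n z := by simp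
    rw [TM2to1.trInit, hr]
    exact congrArg (fun l => (true, e x) :: (false, e y) :: l) List.map_replicate
  rw [this]
  exact Iff.rfl

/-- There is a Turing machine with finitely many states and tape symbols whose halting problem, on
inputs in unary notation, is undecidable. -/
theorem exists_machine_not_computablePred_haltsOn :
    ∃ (Λ Γ : Type) (_ : Fintype Λ) (_ : Fintype Γ) (M : Λ → Γ → Option (Λ × TM0.Stmt Γ)) (q₀ : Λ)
      (blank a₀ a₁ b : Γ), ¬ ComputablePred fun n => HaltsOn M q₀ (inputTape blank a₀ a₁ b n) := by
  -- A partial recursive function that, on input `2 ^ n`, simulates the program with number `n`.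
  let U : ℕ →. ℕ := fun m => (Nat.rfind fun k => Part.some (decide (2 ^ k = m))).bind
    fun n => (Denumerable.ofNat Nat.Partrec.Code n).eval 0
  have hU : Partrec U := by
    refine Partrec.bind (Partrec.rfind ?_) ?_
    · have h : PrimrecPred fun p : ℕ × ℕ => 2 ^ p.2 = p.1 :=
        Primrec.eq.comp ((Primrec₂.unpaired'.1 Nat.Primrec.pow).comp (Primrec.const 2) Primrec.snd)
          Primrec.fst
      exact h.decide.to_comp.partrec
    · exact Nat.Partrec.Code.eval_part.comp
        ((Computable.ofNat Nat.Partrec.Code).comp Computable.snd) (Computable.const 0)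
  have hU₂ (n : ℕ) : U (2 ^ n) = (Denumerable.ofNat Nat.Partrec.Code n).eval 0 := by
    have : n ∈ Nat.rfind fun k => Part.some (decide (2 ^ k = 2 ^ n)) :=
      Nat.mem_rfind.2 ⟨by simp, fun {m} hm => by simp [hm.ne]⟩
    simp only [U, Part.eq_some_iff.2 this, Part.bind_some]
  obtain ⟨c, hc⟩ := ToPartrec.Code.exists_code (Nat.Partrec'.part_iff₁.2 hU)
  let _ : Inhabited PartrecToTM2.Λ' := ⟨PartrecToTM2.trNormal c PartrecToTM2.Cont'.halt⟩
  -- The input of the stack machine is `2 ^ n` in binary notation, a list of `n` zeros and a one.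
  let _ : Fintype PartrecToTM2.K' := ⟨{.main, .rev, .aux, .stack}, fun k => by cases k <;> simp⟩
  obtain ⟨Λ, Γ, i, j, M, q₀, blank, a₀, a₁, b, h⟩ := exists_machine_haltsOn_iff_TM2
    PartrecToTM2.tr _ (PartrecToTM2.tr_supports c PartrecToTM2.Cont'.halt) PartrecToTM2.K'.main
    PartrecToTM2.Γ'.cons PartrecToTM2.Γ'.bit1 PartrecToTM2.Γ'.bit0
  refine ⟨Λ, Γ, i, j, M, q₀, blank, a₀, a₁, b, fun hM => ComputablePred.halting_problem 0 ?_⟩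
  have key (n : ℕ) : HaltsOn M q₀ (inputTape blank a₀ a₁ b n) ↔
      ((Denumerable.ofNat Nat.Partrec.Code n).eval 0).Dom := by
    have h₁ : List.replicate n PartrecToTM2.Γ'.bit0 ++ [PartrecToTM2.Γ'.bit1, PartrecToTM2.Γ'.cons]
        = PartrecToTM2.trList [2 ^ n] := by simp [trNat_two_pow]
    have h₂ : TM2.init PartrecToTM2.K'.main (PartrecToTM2.trList [2 ^ n]) =
        PartrecToTM2.init c [2 ^ n] := by
      rw [TM2.init, PartrecToTM2.init]
      congr 1
      funext k
      cases k <;> rfl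
    have h₃ : c.eval [2 ^ n] = pure <$> U (2 ^ n) := hc (2 ^ n ::ᵥ List.Vector.nil)
    rw [h, h₁, ← hU₂]
    change (StateTransition.eval _ (TM2.init _ _)).Dom ↔ _
    rw [h₂]
    change (StateTransition.eval (TM2.step PartrecToTM2.tr) (PartrecToTM2.init c [2 ^ n])).Dom ↔ _
    rw [PartrecToTM2.tr_eval, h₃]
    exact Iff.rfl
  refine ComputablePred.computable_of_manyOneReducible ⟨Encodable.encode, Computable.encode,
    fun d => ?_⟩ hM
  rw [key, Denumerable.ofNat_encode]

/-! ### Computation histories on a helix -/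

/-- A Turing machine together with the symbols of its inputs: the input with number `n` is the tape
that carries `fst snd rest ⋯ rest`, with `n` copies of `rest`. -/
structure UnaryMachine (Λ Γ : Type) : Type where
  prog : Λ → Γ → Option (Λ × TM0.Stmt Γ)
  start : Λ
  blank : Γ
  fst : Γ
  snd : Γ
  rest : Γ

/-- The symbols of a history: `none` is the border between two rows, `some (q, a)` is a cell that
carries the tape symbol `a`, where `q` is the state of the machine if the head is here, and `none`
otherwise. -/
abbrev HelixSym (Λ Γ : Type) : Type := Option (Option Λ × Γ)

/-- The contents of a cell of a configuration, as a symbol of a history. -/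
noncomputable def TapeCfg.cellAt {Λ Γ : Type} (c : TapeCfg Λ Γ) (z : ℤ) : Option Λ × Γ :=
  (if z = c.pos then some c.state else none, c.tape z)

namespace UnaryMachine

variable {Λ Γ : Type} (P : UnaryMachine Λ Γ)

/-- The initial configuration for the input with number `n`. -/
def init (n : ℕ) : TapeCfg Λ Γ :=
  ⟨P.start, 0, inputTape P.blank P.fst P.snd P.rest n⟩

/-- The machine halts on the input with number `n`. -/
def Halts (n : ℕ) : Prop :=
  HaltsOn P.prog P.start (inputTape P.blank P.fst P.snd P.rest n)

/-- The configuration after `t` steps on the input with number `n`. -/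
def cfg (n t : ℕ) : TapeCfg Λ Γ := (TapeCfg.step P.prog)^[t] (P.init n)

/-- The state in which the head leaves this cell in the given direction, if it does so. -/
def leaves (d : Dir) : HelixSym Λ Γ → Option Λ
  | some (some q, a) => match P.prog q a, d with
    | some (q', .move .left), .left => some q'
    | some (q', .move .right), .right => some q'
    | _, _ => none
  | _ => none

/-- The contents after one step of a cell with contents `b`, where `l` and `r` are the contents of
the neighbouring cells. -/
def nextSym (l b r : HelixSym Λ Γ) : HelixSym Λ Γ :=
  match b with
  | none => none
  | some (some q, a) => match P.prog q a with
    | none => some (some q, a)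
    | some (q', .write a') => some (some q', a')
    | some (_, .move _) => some (none, a)
  | some (none, a) => some ((P.leaves .right l).or (P.leaves .left r), a)

/-- The head tries to leave a cell across the border. -/
def Blocked (l b r : HelixSym Λ Γ) : Prop :=
  ((P.leaves .left b).isSome ∧ l = none) ∨ ((P.leaves .right b).isSome ∧ r = none)

/-- The symbol `d` may appear below `b` if `l` and `r` are the neighbours of `b`. -/
def Allowed (l b r d : HelixSym Λ Γ) : Prop :=
  d = P.nextSym l b r ∧ ¬ P.Blocked l b r

/-- The symbol of a halting configuration. -/
def IsHalting : HelixSym Λ Γ → Prop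
  | some (some q, a) => P.prog q a = none
  | _ => False

/-- A cell without the head. -/
def plain (a : Γ) : HelixSym Λ Γ := some (none, a)

/-- The sequence of the `N` symbols `s i` with the keys `K i` is a halting computation history of
the machine on the input with number `n`. It is a sequence of rows, each of which starts with a
border, wound up to a helix: the symbol below the one at `i` is the next one with the same key. The
conditions are such that a violation is seen by a register automaton that stores two keys. Those
from `prefix_blank` to `suffix_blank` say that the first row shows the input, between blanks. The
lower bounds for `j` in `key_succ` and `allowed` are harmless because this row has at least three
cells. -/
structure IsHelix (n N : ℕ) (K : ℕ → ℚ) (s : ℕ → HelixSym Λ Γ) : Prop where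
  border_zero : 0 < N → s 0 = none
  key_lt : ∀ i, i + 1 < N → s (i + 1) ≠ none → K i < K (i + 1)
  border_key : ∀ i < N, s i = none → K i = K 0
  key_succ : ∀ i j, i + 2 ≤ j → j + 1 < N → K j = K i → K (j + 1) = K (i + 1)
  allowed : ∀ i j, i + 3 ≤ j → j < N → K j = K (i + 1) →
    (∀ j', i + 3 ≤ j' → j' < j → K j' ≠ K (i + 1)) →
    P.Allowed (s i) (s (i + 1)) (s (i + 2)) (s j)
  prefix_blank : ∀ i, 0 < i → i < N → (∀ i', 0 < i' → i' < i → s i' = plain P.blank) →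
    s i = plain P.blank ∨ s i = some (some P.start, P.fst)
  input_snd : ∀ h, 0 < h → (∀ i', 0 < i' → i' < h → s i' = plain P.blank) →
    s h = some (some P.start, P.fst) → h + 1 < N → s (h + 1) = plain P.snd
  input_rest : ∀ h, 0 < h → (∀ i', 0 < i' → i' < h → s i' = plain P.blank) →
    s h = some (some P.start, P.fst) → ∀ j < n, h + 2 + j < N → s (h + 2 + j) = plain P.rest
  suffix_blank : ∀ h, 0 < h → (∀ i', 0 < i' → i' < h → s i' = plain P.blank) →
    s h = some (some P.start, P.fst) → ∀ i, h + 2 + n ≤ i → i < N →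
    (∀ i', h + 2 + n ≤ i' → i' < i → s i' = plain P.blank) → s i = plain P.blank ∨ s i = none
  halting : ∃ i < N, P.IsHalting (s i)

theorem cfg_succ (n t : ℕ) : P.cfg n (t + 1) = (P.cfg n t).step P.prog :=
  Function.iterate_succ_apply' _ _ _

theorem abs_pos_step_sub_le (c : TapeCfg Λ Γ) : |(c.step P.prog).pos - c.pos| ≤ 1 := by
  unfold TapeCfg.step
  rcases P.prog c.state (c.tape c.pos) with _ | ⟨q, (_ | _) | a⟩ <;> simp [TapeCfg.exec]

theorem leaves_left_cellAt (c : TapeCfg Λ Γ) (z : ℤ) :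
    P.leaves .left (some (c.cellAt z)) =
      if c.pos = z ∧ (c.step P.prog).pos = z - 1 then some (c.step P.prog).state else none := by
  unfold TapeCfg.step TapeCfg.cellAt leaves
  by_cases h : z = c.pos
  · subst h
    rcases hp : P.prog c.state (c.tape c.pos) with _ | ⟨q, (_ | _) | a⟩ <;>
      simp [TapeCfg.exec, hp]
    all_goals omega
  · simp [h, Ne.symm h]

theorem leaves_right_cellAt (c : TapeCfg Λ Γ) (z : ℤ) :
    P.leaves .right (some (c.cellAt z)) =
      if c.pos = z ∧ (c.step P.prog).pos = z + 1 then some (c.step P.prog).state else none := by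
  unfold TapeCfg.step TapeCfg.cellAt leaves
  by_cases h : z = c.pos
  · subst h
    rcases hp : P.prog c.state (c.tape c.pos) with _ | ⟨q, (_ | _) | a⟩ <;>
      simp [TapeCfg.exec, hp]
    all_goals omega
  · simp [h, Ne.symm h]

theorem blocked_cellAt_iff (c : TapeCfg Λ Γ) (z : ℤ) (l r : HelixSym Λ Γ) :
    P.Blocked l (some (c.cellAt z)) r ↔ c.pos = z ∧
      ((c.step P.prog).pos = z - 1 ∧ l = none ∨ (c.step P.prog).pos = z + 1 ∧ r = none) := by
  rw [Blocked, leaves_left_cellAt, leaves_right_cellAt]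
  split_ifs with h₁ h₂ h₂ <;> simp <;> tauto

/-- A border cell may be taken for a neighbour unless the head is on the other side of it. -/
theorem nextSym_cellAt (c : TapeCfg Λ Γ) (z : ℤ) (l r : HelixSym Λ Γ)
    (hl : l = some (c.cellAt (z - 1)) ∨ l = none ∧ c.pos ≠ z - 1)
    (hr : r = some (c.cellAt (z + 1)) ∨ r = none ∧ c.pos ≠ z + 1) :
    P.nextSym l (some (c.cellAt z)) r = some ((c.step P.prog).cellAt z) := by
  have hl' : P.leaves .right l = if c.pos = z - 1 ∧ (c.step P.prog).pos = z
      then some (c.step P.prog).state else none := by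
    rcases hl with rfl | ⟨rfl, h⟩
    · rw [leaves_right_cellAt]; simp
    · simp [h, leaves]
  have hr' : P.leaves .left r = if c.pos = z + 1 ∧ (c.step P.prog).pos = z
      then some (c.step P.prog).state else none := by
    rcases hr with rfl | ⟨rfl, h⟩
    · rw [leaves_left_cellAt]; simp
    · simp [h, leaves]
  by_cases h : z = c.pos
  · subst h
    clear hl hr hl' hr'
    unfold TapeCfg.step TapeCfg.cellAt nextSym
    rcases hp : P.prog c.state (c.tape c.pos) with _ | ⟨q, (_ | _) | a⟩ <;>
      simp [TapeCfg.exec, hp]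
    exact (if_neg (by omega)).symm
  · have h₁ : c.cellAt z = (none, c.tape z) := by simp [TapeCfg.cellAt, h]
    have h₂ : (c.step P.prog).tape z = c.tape z := by
      unfold TapeCfg.step
      rcases P.prog c.state (c.tape c.pos) with _ | ⟨q, (_ | _) | a⟩ <;> simp [TapeCfg.exec, h]
    have h₃ := abs_le.1 (P.abs_pos_step_sub_le c)
    rw [h₁, nextSym, hl', hr', TapeCfg.cellAt, h₂]
    congr 2
    split_ifs <;> first | rfl | omega

end UnaryMachine

/-! ### Histories come from halting computations -/

namespace UnaryMachine

variable {Λ Γ : Type} (P : UnaryMachine Λ Γ)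

theorem cellAt_init (n : ℕ) (z : ℤ) : (P.init n).cellAt z =
    if z = 0 then (some P.start, P.fst) else if z = 1 then (none, P.snd)
      else if 2 ≤ z ∧ z < n + 2 then (none, P.rest) else (none, P.blank) := by
  unfold TapeCfg.cellAt init inputTape
  split_ifs <;> simp_all

theorem Halts.of_isHalting {P : UnaryMachine Λ Γ} {n t : ℕ} {z : ℤ}
    (h : P.IsHalting (some ((P.cfg n t).cellAt z))) : P.Halts n := by
  refine ⟨t, ?_⟩
  change (P.cfg n t).Halted P.prog
  unfold TapeCfg.cellAt at h
  split_ifs at h with hz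
  · rw [hz] at h; exact h
  · exact h.elim

namespace IsHelix

variable {P} {n N : ℕ} {K : ℕ → ℚ} {s : ℕ → HelixSym Λ Γ}

/-- The first row of a history shows the initial configuration, with the head at some `h`, and ends
at some `L`, which may lie beyond the end of the history. -/
theorem exists_first_row (H : P.IsHelix n N K s) :
    ∃ h L, 0 < h ∧ h + 2 + n ≤ L ∧ (L < N → s L = none) ∧
      ∀ c, 0 < c → c < L → c < N → s c = some ((P.init n).cellAt ((c : ℤ) - h)) := by
  classical
  obtain ⟨i₀, hi₀, hq⟩ := H.halting
  have hs0 : s 0 = none := H.border_zero (by omega)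
  have hi₀0 : 0 < i₀ := by
    rcases Nat.eq_zero_or_pos i₀ with rfl | h
    · rw [hs0] at hq; exact hq.elim
    · exact h
  have hex : ∃ h, 0 < h ∧ s h ≠ plain P.blank :=
    ⟨i₀, hi₀0, fun h => by rw [h] at hq; exact hq.elim⟩
  obtain ⟨h, ⟨hh0, hh⟩, hmin, hi₀h⟩ :
      ∃ h, (0 < h ∧ s h ≠ plain P.blank) ∧
        (∀ i', 0 < i' → i' < h → s i' = plain P.blank) ∧ h ≤ i₀ :=
    ⟨Nat.find hex, Nat.find_spec hex,
      fun i' h0 hi' => by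
        by_contra hne
        exact Nat.find_min hex hi' ⟨h0, hne⟩,
      Nat.find_min' hex ⟨hi₀0, fun h => by rw [h] at hq; exact hq.elim⟩⟩
  have hhead : s h = some (some P.start, P.fst) :=
    (H.prefix_blank h hh0 (by omega) hmin).resolve_left hh
  -- If the history ends within the first row, every large number may serve as its length.
  have hexL : ∃ L, h + 2 + n ≤ L ∧ (L < N → s L = none) :=
    ⟨max N (h + 2 + n), by omega, fun h => by omega⟩
  obtain ⟨L, hL, hLmin⟩ : ∃ L, (h + 2 + n ≤ L ∧ (L < N → s L = none)) ∧
      ∀ i, h + 2 + n ≤ i → i < L → s i ≠ none :=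
    ⟨Nat.find hexL, Nat.find_spec hexL, fun i hi hiL hn =>
      Nat.find_min hexL hiL ⟨hi, fun _ => hn⟩⟩
  have hsuf : ∀ c, h + 2 + n ≤ c → c < L → c < N → s c = plain P.blank := by
    intro c
    induction c using Nat.strong_induction_on with
    | _ c ih =>
      intro h₁ h₂ h₃
      refine (H.suffix_blank h hh0 hmin hhead c h₁ h₃ fun i' h₄ h₅ => ?_).resolve_right
        (hLmin c h₁ h₂)
      exact ih i' h₅ h₄ (by omega) (by omega)
  refine ⟨h, L, hh0, hL.1, hL.2, fun c h₁ h₂ h₃ => ?_⟩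
  rw [cellAt_init]
  rcases lt_trichotomy c h with hc | hc | hc
  · rw [if_neg (by omega), if_neg (by omega), if_neg (by omega)]
    exact hmin c h₁ hc
  · rw [if_pos (by omega), hc, hhead]
  · rw [if_neg (by omega)]
    rcases Nat.eq_or_lt_of_le hc with hc | hc
    · rw [if_pos (by omega), ← hc]
      exact H.input_snd h hh0 hmin hhead (by omega)
    · rw [if_neg (by omega)]
      by_cases hcn : c < h + 2 + n
      · rw [if_pos (by omega)]
        obtain ⟨j, rfl⟩ : ∃ j, c = h + 2 + j := ⟨c - (h + 2), by omega⟩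
        exact H.input_rest h hh0 hmin hhead j (by omega) h₃
      · rw [if_neg (by omega)]
        exact hsuf c (by omega) h₂ h₃

section

variable {L : ℕ} (H : P.IsHelix n N K s) (hL2 : 2 ≤ L) (hL : L < N → s L = none)
  (hrow : ∀ c, 0 < c → c < L → c < N → s c ≠ none)

include H hL2 hL

theorem key_add (i : ℕ) (hi : i + L < N) : K (i + L) = K i := by
  induction i with
  | zero => rw [zero_add] at hi ⊢; exact H.border_key L hi (hL hi)
  | succ i ih =>
    have := H.key_succ i (i + L) (by omega) (by omega) (ih (by omega))
    rwa [show i + L + 1 = i + 1 + L by ring] at this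

theorem key_mod (i : ℕ) (hi : i < N) : K i = K (i % L) := by
  induction i using Nat.strong_induction_on with
  | _ i ih =>
    by_cases h : i < L
    · rw [Nat.mod_eq_of_lt h]
    · obtain ⟨j, rfl⟩ : ∃ j, i = j + L := ⟨i - L, by omega⟩
      rw [H.key_add hL2 hL j hi, Nat.add_mod_right]
      exact ih j (by omega) (by omega)

include hrow

omit hL2 hL in
theorem key_lt_of_lt {i j : ℕ} (hij : i < j) (hj : j < L) (hN : j < N) : K i < K j := by
  induction j with
  | zero => omega
  | succ j ih =>
    have h := H.key_lt j hN (hrow _ (by omega) hj hN)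
    rcases Nat.lt_succ_iff_lt_or_eq.1 hij with hlt | rfl
    · exact (ih hlt (by omega) (by omega)).trans h
    · exact h

/-- A key does not come again before one turn of the helix is complete. -/
theorem key_ne {i j : ℕ} (hij : i < j) (hj : j < i + L) (hN : j < N) : K j ≠ K i := by
  rw [H.key_mod hL2 hL i (by omega), H.key_mod hL2 hL j hN]
  have hne : i % L ≠ j % L := fun h => by
    have := (Nat.modEq_iff_dvd' hij.le).1 h
    have := Nat.le_of_dvd (by omega) this
    omega
  have h₁ := Nat.mod_lt i (show L > 0 by omega)
  have h₂ := Nat.mod_lt j (show L > 0 by omega)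
  have h₃ := Nat.mod_le i L
  have h₄ := Nat.mod_le j L
  rcases hne.lt_or_gt with h | h
  · exact (H.key_lt_of_lt hrow h h₂ (by omega)).ne'
  · exact (H.key_lt_of_lt hrow h h₁ (by omega)).ne

theorem allowed_add (i : ℕ) (hi : i + 1 + L < N) :
    P.Allowed (s i) (s (i + 1)) (s (i + 2)) (s (i + 1 + L)) := by
  refine H.allowed i (i + 1 + L) (by omega) hi (H.key_add hL2 hL _ hi) fun j' h₁ h₂ => ?_
  exact H.key_ne hL2 hL hrow (by omega) h₂ (by omega)

end

theorem halts (H : P.IsHelix n N K s) : P.Halts n := by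
  obtain ⟨h, L, hh0, hhL, hL, hfirst⟩ := H.exists_first_row
  have hL2 : 2 ≤ L := by omega
  have hrow : ∀ c, 0 < c → c < L → c < N → s c ≠ none := fun c h₁ h₂ h₃ => by
    rw [hfirst c h₁ h₂ h₃]; simp
  have hA := H.allowed_add hL2 hL hrow
  -- The row `t` shows the configuration after `t` steps, and its head stays inside the row if the
  -- row is complete.
  have key (t : ℕ) :
      (∀ c < L, t * L + c < N →
        s (t * L + c) = if c = 0 then none else some ((P.cfg n t).cellAt ((c : ℤ) - h))) ∧
      ((t + 1) * L ≤ N → 1 ≤ (P.cfg n t).pos + h ∧ (P.cfg n t).pos + h ≤ L - 1) := by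
    induction t with
    | zero =>
      refine ⟨fun c hc hN => ?_, fun _ => ?_⟩
      · rw [zero_mul, zero_add] at hN ⊢
        split_ifs with h0
        · rw [h0]; exact H.border_zero (by omega)
        · exact hfirst c (by omega) hc hN
      · have : (P.cfg n 0).pos = 0 := rfl
        omega
    | succ t ih =>
      obtain ⟨ih₁, ih₂⟩ := ih
      have e₁ : (t + 1) * L = t * L + L := by ring
      have e₂ : (t + 1 + 1) * L = t * L + L + L := by ring
      rw [e₁] at ih₂
      rw [e₁, e₂, cfg_succ]
      have hborder : t * L + L < N → s (t * L + L) = none := by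
        intro hN
        rcases Nat.eq_zero_or_pos t with rfl | ht
        · rw [zero_mul, zero_add] at hN ⊢; exact hL hN
        · have hpos : 0 < t * L := Nat.mul_pos ht (by omega)
          have := (hA (t * L - 1) (by omega)).1
          rw [show t * L - 1 + 1 = t * L by omega] at this
          rw [this]
          have h0 := ih₁ 0 (by omega) (by omega)
          rw [add_zero, if_pos rfl] at h0
          rw [h0]; rfl
      -- The rule for the cell below the cell `c` of the row `t`.
      have hcell : ∀ c, 0 < c → c < L → t * L + L + c < N →
          P.Allowed (s (t * L + (c - 1))) (some ((P.cfg n t).cellAt ((c : ℤ) - h)))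
            (s (t * L + (c + 1))) (s (t * L + L + c)) := by
        intro c h0 hc hN
        have := hA (t * L + (c - 1)) (by omega)
        rw [show t * L + (c - 1) + 1 = t * L + c by omega,
          show t * L + (c - 1) + 2 = t * L + (c + 1) by omega,
          show t * L + c + L = t * L + L + c by omega, ih₁ c hc (by omega),
          if_neg (by omega)] at this
        exact this
      have hleft : ∀ c, 0 < c → c < L → t * L + L + c < N →
          s (t * L + (c - 1)) =
            if c = 1 then none else some ((P.cfg n t).cellAt ((c : ℤ) - h - 1)) := by
        intro c h0 hc hN
        rw [ih₁ (c - 1) (by omega) (by omega)]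
        by_cases h1 : c = 1
        · rw [if_pos (by omega), if_pos h1]
        · rw [if_neg (by omega), if_neg h1]
          congr 2; omega
      have hright : ∀ c, 0 < c → c < L → t * L + L + c < N →
          s (t * L + (c + 1)) =
            if c + 1 = L then none else some ((P.cfg n t).cellAt ((c : ℤ) - h + 1)) := by
        intro c h0 hc hN
        by_cases h1 : c + 1 = L
        · rw [if_pos h1, h1]; exact hborder (by omega)
        · rw [ih₁ (c + 1) (by omega) (by omega), if_neg h1, if_neg (by omega)]
          congr 2; push_cast; ring
      refine ⟨fun c hc hN => ?_, fun hN => ?_⟩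
      · split_ifs with h0
        · subst h0; exact hborder (by omega)
        · have hpos := ih₂ (by omega)
          have hc0 : 0 < c := by omega
          rw [(hcell c hc0 hc hN).1]
          refine P.nextSym_cellAt _ _ _ _ ?_ ?_
          · rw [hleft c hc0 hc hN]
            split_ifs with h1
            · exact .inr ⟨rfl, by omega⟩
            · exact .inl rfl
          · rw [hright c hc0 hc hN]
            split_ifs with h1
            · exact .inr ⟨rfl, by omega⟩
            · exact .inl rfl
      · have hpos := ih₂ (by omega)
        have hstep := abs_le.1 (P.abs_pos_step_sub_le (P.cfg n t))
        obtain ⟨c, hc⟩ : ∃ c : ℕ, (c : ℤ) = (P.cfg n t).pos + h :=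
          ⟨((P.cfg n t).pos + h).toNat, Int.toNat_of_nonneg (by omega)⟩
        have hb := (hcell c (by omega) (by omega) (by omega)).2
        rw [blocked_cellAt_iff, hleft c (by omega) (by omega) (by omega),
          hright c (by omega) (by omega) (by omega)] at hb
        simp only [ite_eq_left_iff, reduceCtorEq, imp_false, not_not] at hb
        omega
  obtain ⟨i, hi, hq⟩ := H.halting
  have hdiv := Nat.div_add_mod' i L
  rw [← hdiv, (key (i / L)).1 (i % L) (Nat.mod_lt _ (by omega)) (by omega)] at hq
  split_ifs at hq
  · exact hq.elim
  · exact Halts.of_isHalting hq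

end IsHelix
end UnaryMachine

/-! ### Halting computations have histories -/

namespace UnaryMachine

variable {Λ Γ : Type} (P : UnaryMachine Λ Γ)

/-- The history of the machine on the input with number `n`, in rows of length `L` that show the
initial position of the head at `h`. -/
noncomputable def history (n h L i : ℕ) : HelixSym Λ Γ :=
  if i % L = 0 then none else some ((P.cfg n (i / L)).cellAt (((i % L : ℕ) : ℤ) - h))

theorem history_eq (n h L t c : ℕ) (hc : c < L) : P.history n h L (t * L + c) =
    if c = 0 then none else some ((P.cfg n t).cellAt ((c : ℤ) - h)) := by
  have h₁ : (t * L + c) % L = c := by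
    rw [Nat.mul_add_mod_self_right, Nat.mod_eq_of_lt hc]
  have h₂ : (t * L + c) / L = t := by
    rw [mul_comm, Nat.mul_add_div (by omega), Nat.div_eq_of_lt hc, add_zero]
  rw [history, h₁, h₂]

theorem abs_pos_cfg_le (n t : ℕ) : |(P.cfg n t).pos| ≤ t := by
  induction t with
  | zero => simp [cfg, init]
  | succ t ih =>
    have := P.abs_pos_step_sub_le (P.cfg n t)
    rw [cfg_succ]
    rw [abs_le] at *
    push_cast
    omega

/-- A halting computation fits into a helix, with the numbers of the columns, moved by a constant
`m`, for keys. -/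
theorem Halts.exists_isHelix {P : UnaryMachine Λ Γ} {n : ℕ} (hP : P.Halts n) (m : ℕ) :
    ∃ (N : ℕ) (k : ℕ → ℕ) (s : ℕ → HelixSym Λ Γ),
      P.IsHelix n N (fun i => ((m + k i : ℕ) : ℚ)) s := by
  obtain ⟨T, hT⟩ := hP
  -- The head moves by at most `T` cells, so it stays strictly between the borders.
  obtain ⟨h, hh⟩ : ∃ h, h = T + 1 := ⟨_, rfl⟩
  obtain ⟨L, hL⟩ : ∃ L, L = 2 * T + n + 4 := ⟨_, rfl⟩
  have hpos (t : ℕ) (ht : t ≤ T) : 1 ≤ (P.cfg n t).pos + h ∧ (P.cfg n t).pos + h ≤ L - 2 := by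
    have := abs_le.1 (P.abs_pos_cfg_le n t)
    omega
  have hs := fun t c hc => P.history_eq n h L t c hc
  have hinit : ∀ c, 0 < c → c < L →
      P.history n h L c = some ((P.init n).cellAt ((c : ℤ) - h)) := by
    intro c h0 hc
    have := hs 0 c hc
    rwa [zero_mul, zero_add, if_neg h0.ne'] at this
  have hblank : ∀ c, 0 < c → c < h → P.history n h L c = plain P.blank := by
    intro c h0 hc
    rw [hinit c h0 (by omega), cellAt_init, if_neg (by omega), if_neg (by omega),
      if_neg (by omega)]
    rfl
  have hhead : P.history n h L h = some (some P.start, P.fst) := by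
    rw [hinit h (by omega) (by omega), cellAt_init, if_pos (by omega)]
  have huniq : ∀ h', 0 < h' → (∀ i', 0 < i' → i' < h' → P.history n h L i' = plain P.blank) →
      P.history n h L h' = some (some P.start, P.fst) → h' = h := by
    intro h' h₁ h₂ h₃
    rcases lt_trichotomy h' h with hlt | heq | hlt
    · rw [hblank h' h₁ hlt] at h₃; simp [plain] at h₃
    · exact heq
    · have := h₂ h (by omega) hlt
      rw [hhead] at this; simp [plain] at this
  have hborder : P.history n h L L = none := by
    have := hs 1 0 (by omega)
    rwa [one_mul, add_zero, if_pos rfl] at this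
  have hmod (i : ℕ) (hi : (i + 1) % L ≠ 0) : (i + 1) % L = i % L + 1 := by
    have h₁ := Nat.mod_lt i (show L > 0 by omega)
    rw [Nat.add_mod, Nat.mod_eq_of_lt (show 1 < L by omega)] at hi ⊢
    exact Nat.mod_eq_of_lt (by
      by_contra hc
      rw [show i % L + 1 = L by omega, Nat.mod_self] at hi
      exact hi rfl)
  refine ⟨(T + 1) * L, fun i => i % L, P.history n h L, ?_, ?_, ?_, ?_, ?_, ?_, ?_, ?_, ?_, ?_⟩
  · intro _
    simp [history]
  · intro i _ hn
    have : (i + 1) % L ≠ 0 := fun h0 => hn (if_pos h0)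
    simp only [hmod i this]
    exact_mod_cast (by omega)
  · intro i _ hn
    have : i % L = 0 := by
      by_contra h0
      rw [history, if_neg h0] at hn
      simp at hn
    simp [this]
  · intro i j _ _ hK
    have hK' : j % L = i % L := by
      have : m + j % L = m + i % L := Nat.cast_injective hK
      omega
    simp only [Nat.add_mod j 1, Nat.add_mod i 1, hK']
  · intro i j hij hj hK hne
    have hK' : j % L = (i + 1) % L := by
      have : m + j % L = m + (i + 1) % L := Nat.cast_injective hK
      omega
    obtain ⟨d, hd⟩ := (Nat.modEq_iff_dvd' (show i + 1 ≤ j by omega)).1 (Eq.symm hK')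
    have hd1 : d = 1 := by
      rcases d with _ | _ | d
      · omega
      · rfl
      · refine absurd ?_ (hne (i + 1 + L) (by omega) ?_)
        · simp
        · have : L * (d + 1 + 1) = L * d + L + L := by ring
          omega
    rw [hd1, mul_one] at hd
    obtain ⟨t, c, hc, hi⟩ : ∃ t c, c < L ∧ i + 1 = t * L + c :=
      ⟨(i + 1) / L, (i + 1) % L, Nat.mod_lt _ (by omega), (Nat.div_add_mod' _ _).symm⟩
    have hj' : j = (t + 1) * L + c := by rw [add_mul]; omega
    have htT : t + 1 ≤ T := by
      have : (t + 1) * L < (T + 1) * L := by omega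
      exact Nat.lt_succ_iff.1 (Nat.lt_of_mul_lt_mul_right this)
    rw [hj', hi, hs t c hc, hs (t + 1) c hc]
    by_cases h0 : c = 0
    · rw [if_pos h0, if_pos h0]
      exact ⟨rfl, by simp [Blocked, leaves]⟩
    · rw [if_neg h0, if_neg h0]
      have hl : P.history n h L i =
          if c = 1 then none else some ((P.cfg n t).cellAt ((c : ℤ) - h - 1)) := by
        rw [show i = t * L + (c - 1) by omega, hs t (c - 1) (by omega)]
        by_cases h1 : c = 1
        · rw [if_pos (by omega), if_pos h1]
        · rw [if_neg (by omega), if_neg h1]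
          congr 2; omega
      have hr : P.history n h L (i + 2) =
          if c + 1 = L then none else some ((P.cfg n t).cellAt ((c : ℤ) - h + 1)) := by
        by_cases h1 : c + 1 = L
        · have := hs (t + 1) 0 (by omega)
          rw [if_pos rfl, add_zero] at this
          rw [if_pos h1, show i + 2 = (t + 1) * L by rw [add_mul]; omega, this]
        · rw [show i + 2 = t * L + (c + 1) by omega, hs t (c + 1) (by omega), if_neg h1,
            if_neg (by omega)]
          congr 2; push_cast; ring
      have h₁ := hpos t (by omega)
      have h₂ := hpos (t + 1) htT
      rw [cfg_succ] at h₂ ⊢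
      constructor
      · refine (P.nextSym_cellAt _ _ _ _ ?_ ?_).symm
        · rw [hl]
          split_ifs with h1
          · exact .inr ⟨rfl, by omega⟩
          · exact .inl rfl
        · rw [hr]
          split_ifs with h1
          · exact .inr ⟨rfl, by omega⟩
          · exact .inl rfl
      · rw [blocked_cellAt_iff, hl, hr]
        simp only [ite_eq_left_iff, reduceCtorEq, imp_false, not_not]
        omega
  · intro i h0 hi hb
    rcases lt_trichotomy i h with hlt | heq | hlt
    · exact .inl (hblank i h0 hlt)
    · exact .inr (heq ▸ hhead)
    · have := hb h (by omega) hlt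
      rw [hhead] at this; simp [plain] at this
  · intro h' h₁ h₂ h₃ _
    rw [huniq h' h₁ h₂ h₃, hinit (h + 1) (by omega) (by omega), cellAt_init, if_neg (by omega),
      if_pos (by omega)]
    rfl
  · intro h' h₁ h₂ h₃ j hj _
    rw [huniq h' h₁ h₂ h₃, hinit (h + 2 + j) (by omega) (by omega), cellAt_init,
      if_neg (by omega), if_neg (by omega), if_pos (by omega)]
    rfl
  · intro h' h₁ h₂ h₃ i hi _ hb
    rw [huniq h' h₁ h₂ h₃] at hi hb
    rcases lt_trichotomy i L with hlt | heq | hlt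
    · left
      rw [hinit i (by omega) hlt, cellAt_init, if_neg (by omega), if_neg (by omega),
        if_neg (by omega)]
      rfl
    · exact .inr (heq ▸ hborder)
    · have := hb L (by omega) hlt
      rw [hborder] at this; simp [plain] at this
  · have hp := hpos T le_rfl
    obtain ⟨c, hc⟩ : ∃ c : ℕ, (c : ℤ) = (P.cfg n T).pos + h :=
      ⟨((P.cfg n T).pos + h).toNat, Int.toNat_of_nonneg (by omega)⟩
    refine ⟨T * L + c, by rw [add_mul]; omega, ?_⟩
    rw [hs T c (by omega), if_neg (by omega), hc, add_sub_cancel_right]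
    simp only [TapeCfg.cellAt, if_pos]
    exact hT

end UnaryMachine

/-! ### An automaton that recognizes the words that are no histories -/

/-- The registers of the automaton: one for each symbol, which is never changed, and two that store
keys. -/
inductive HelixReg (S : Type) : Type
  | sym (d : S)
  | fst
  | snd
  deriving Fintype

/-- The contents of a register, where `v` tells the contents of the constant ones. -/
def HelixReg.val {S : Type} (v : S → ℚ) (a b : ℚ) : HelixReg S → ℚ
  | sym d => v d
  | fst => a
  | snd => b

/-- The tests of the current letter; `invalid` says that it does not stand for a symbol. -/
inductive HelixTest (S : Type) : Type
  | any
  | eq (r : HelixReg S)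
  | ne (r : HelixReg S)
  | le (r : HelixReg S)
  | invalid
  deriving Fintype

/-- The letter `x` passes the test. -/
def HelixTest.Holds {S : Type} (v : S → ℚ) (a b x : ℚ) : HelixTest S → Prop
  | any => True
  | eq r => x = r.val v a b
  | ne r => x ≠ r.val v a b
  | le r => x ≤ r.val v a b
  | invalid => ∀ d, x ≠ v d

/-- The current letter is ignored or stored in one of the two registers for keys. -/
inductive HelixUpdate : Type
  | keep
  | fst
  | snd
  deriving DecidableEq

instance : Fintype HelixUpdate :=
  ⟨{.keep, .fst, .snd}, fun t => by cases t <;> decide⟩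

/-- The new contents of the first register for keys. -/
def HelixUpdate.newFst (a x : ℚ) : HelixUpdate → ℚ
  | fst => x
  | _ => a

/-- The new contents of the second register for keys. -/
def HelixUpdate.newSnd (b x : ℚ) : HelixUpdate → ℚ
  | snd => x
  | _ => b

/-- The states of the automaton, except those that count the copies of the last input symbol. A name
ends in `Key` or `Sym` according to the kind of the next letter, up to primes and subscripts. The
states are grouped by the condition of `UnaryMachine.IsHelix` whose violation they look for. Symbols
that were read are kept in the state, keys are kept in the registers. -/
inductive HelixState (S : Type) : Type
  -- the start, the result of a confirmed violation, and the skipping of cells, where a letter that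
  -- should stand for a symbol and does not is a violation
  | initial
  | accept
  | skipKey
  | skipSym
  -- `key_lt`
  | ltSym
  | ltKey
  | ltSym'
  -- `border_key`
  | borderSym
  | borderKey
  | borderSym'
  -- `key_succ`
  | succSym₀
  | succKey₁
  | succSym
  | succKey
  | succSym'
  | succKey'
  -- `allowed`
  | leftSym
  | middleKey (l : S)
  | middleSym (l : S)
  | rightKey (l b : S)
  | rightSym (l b : S)
  | belowKey (l b r : S)
  | belowSym (l b r : S)
  | belowSym' (l b r : S)
  -- `border_zero`, `prefix_blank`, `input_snd` and, after the counting states, `suffix_blank`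
  | zeroSym
  | prefixKey
  | prefixSym
  | sndKey
  | sndSym
  | suffixKey
  | suffixSym
  -- `halting`
  | haltKey
  | haltSym
  deriving Fintype

/-- The states in which the automaton may be before an arbitrary cell. -/
def HelixState.IsInitial {S : Type} (q : HelixState S) : Prop := q = .initial ∨ q = .skipKey

/-- The final states. A word that ends before a halting symbol was read is accepted. -/
def HelixState.IsFinal {S : Type} (q : HelixState S) : Prop :=
  q = .accept ∨ q = .initial ∨ q = .haltKey ∨ q = .haltSym

namespace UnaryMachine

variable {Λ Γ : Type} (P : UnaryMachine Λ Γ)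

open HelixState HelixTest

/-- The transitions of the automaton between its named states: state, test, update, new state. Each
path from `initial` to `accept` guesses where the word violates one condition of
`UnaryMachine.IsHelix`; the first part of the name of a transition tells which one. -/
inductive BaseTrans : HelixState (HelixSym Λ Γ) → HelixTest (HelixSym Λ Γ) → HelixUpdate →
    HelixState (HelixSym Λ Γ) → Prop
  | accept : BaseTrans accept any .keep accept
  | skip_key {q} : q.IsInitial → BaseTrans q any .keep skipSym
  | skip_sym : BaseTrans skipSym any .keep skipKey
  | skip_accept : BaseTrans skipSym invalid .keep accept
  | lt_store {q} : q.IsInitial → BaseTrans q any .fst ltSym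
  | lt_sym : BaseTrans ltSym any .keep ltKey
  | lt_key : BaseTrans ltKey (le .fst) .keep ltSym'
  | lt_accept : BaseTrans ltSym' (ne (.sym none)) .keep accept
  | border_store : BaseTrans initial any .fst borderSym
  | border_sym : BaseTrans borderSym any .keep borderKey
  | border_skip : BaseTrans borderKey any .keep borderSym
  | border_key : BaseTrans borderKey (ne .fst) .keep borderSym'
  | border_accept : BaseTrans borderSym' (eq (.sym none)) .keep accept
  | succ_store {q} : q.IsInitial → BaseTrans q any .fst succSym₀
  | succ_sym₀ : BaseTrans succSym₀ any .keep succKey₁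
  | succ_key₁ : BaseTrans succKey₁ any .snd succSym
  | succ_sym : BaseTrans succSym any .keep succKey
  | succ_skip : BaseTrans succKey any .keep succSym
  | succ_key : BaseTrans succKey (eq .fst) .keep succSym'
  | succ_sym' : BaseTrans succSym' any .keep succKey'
  | succ_accept : BaseTrans succKey' (ne .snd) .keep accept
  | left_key {q} : q.IsInitial → BaseTrans q any .keep leftSym
  | left_sym (l) : BaseTrans leftSym (eq (.sym l)) .keep (middleKey l)
  | middle_key (l) : BaseTrans (middleKey l) any .fst (middleSym l)
  | middle_sym (l b) : BaseTrans (middleSym l) (eq (.sym b)) .keep (rightKey l b)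
  | right_key (l b) : BaseTrans (rightKey l b) any .keep (rightSym l b)
  | right_sym (l b r) : BaseTrans (rightSym l b) (eq (.sym r)) .keep (belowKey l b r)
  | below_skip (l b r) : BaseTrans (belowKey l b r) (ne .fst) .keep (belowSym l b r)
  | below_sym (l b r) : BaseTrans (belowSym l b r) any .keep (belowKey l b r)
  | below_key (l b r) : BaseTrans (belowKey l b r) (eq .fst) .keep (belowSym' l b r)
  | below_accept (l b r d) : ¬ P.Allowed l b r d →
      BaseTrans (belowSym' l b r) (eq (.sym d)) .keep accept
  | zero_key : BaseTrans initial any .keep zeroSym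
  | zero_accept : BaseTrans zeroSym (ne (.sym none)) .keep accept
  | zero_sym : BaseTrans zeroSym any .keep prefixKey
  | prefix_key : BaseTrans prefixKey any .keep prefixSym
  | prefix_blank : BaseTrans prefixSym (eq (.sym (plain P.blank))) .keep prefixKey
  | prefix_head : BaseTrans prefixSym (eq (.sym (some (some P.start, P.fst)))) .keep sndKey
  | prefix_accept (d) : d ≠ plain P.blank → d ≠ some (some P.start, P.fst) →
      BaseTrans prefixSym (eq (.sym d)) .keep accept
  | snd_key : BaseTrans sndKey any .keep sndSym
  | snd_accept : BaseTrans sndSym (ne (.sym (plain P.snd))) .keep accept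
  | suffix_key : BaseTrans suffixKey any .keep suffixSym
  | suffix_sym : BaseTrans suffixSym (eq (.sym (plain P.blank))) .keep suffixKey
  | suffix_accept (d) : d ≠ plain P.blank → d ≠ none →
      BaseTrans suffixSym (eq (.sym d)) .keep accept
  | halt_zero : BaseTrans initial any .keep haltSym
  | halt_sym (d) : ¬ P.IsHalting d → BaseTrans haltSym (eq (.sym d)) .keep haltKey
  | halt_key : BaseTrans haltKey any .keep haltSym

/-- The transitions of the automaton. The state `k : ℕ` is that before the last `k` letters of the
cells `rest ⋯ rest` of the input. -/
inductive Trans (n : ℕ) : HelixState (HelixSym Λ Γ) ⊕ ℕ → HelixTest (HelixSym Λ Γ) → HelixUpdate →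
    HelixState (HelixSym Λ Γ) ⊕ ℕ → Prop
  | base {q t u q'} : P.BaseTrans q t u q' → Trans n (.inl q) t u (.inl q')
  | enter : Trans n (.inl sndSym) any .keep (.inr (2 * n))
  | count (k) : k < 2 * n → Trans n (.inr (k + 1)) any .keep (.inr k)
  | rest_accept (j) : j < n → Trans n (.inr (2 * j + 1)) (ne (.sym (plain P.rest))) .keep
      (.inl accept)
  | leave : Trans n (.inr 0) any .keep (.inl suffixSym)

/-- On the word `x 0, x 1, …`, the automaton can be in state `q`, with the keys `a` and `b` stored,
after `p` letters. -/
inductive Run (n : ℕ) (v : HelixSym Λ Γ → ℚ) (x : ℕ → ℚ) :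
    ℕ → HelixState (HelixSym Λ Γ) ⊕ ℕ → ℚ → ℚ → Prop
  | zero : Run n v x 0 (.inl initial) 0 0
  | succ {p q a b t u q'} : Run n v x p q a b → P.Trans n q t u q' → t.Holds v a b (x p) →
      Run n v x (p + 1) q' (u.newFst a (x p)) (u.newSnd b (x p))

/-- The automaton accepts the first `p` letters of `x`. -/
def Accepts (n : ℕ) (v : HelixSym Λ Γ → ℚ) (x : ℕ → ℚ) (p : ℕ) : Prop :=
  ∃ q a b, P.Run n v x p (.inl q) a b ∧ q.IsFinal

/-- There is an input head at the cell `h` of the first row, and only blanks to the left of it. -/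
def HeadAt (s : ℕ → HelixSym Λ Γ) (h : ℕ) : Prop :=
  0 < h ∧ (∀ i, 0 < i → i < h → s i = plain P.blank) ∧ s h = some (some P.start, P.fst)

/-- What is known about a word if the automaton is in this state after `p` letters. -/
def Invariant (n : ℕ) (K : ℕ → ℚ) (s : ℕ → HelixSym Λ Γ) (p : ℕ) (a b : ℚ) :
    HelixState (HelixSym Λ Γ) ⊕ ℕ → Prop
  | .inl initial => p = 0
  | .inl accept => False
  | .inl skipKey => ∃ i, p = 2 * i
  | .inl skipSym => ∃ i, p = 2 * i + 1
  | .inl ltSym => ∃ i, p = 2 * i + 1 ∧ a = K i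
  | .inl ltKey => ∃ i, p = 2 * (i + 1) ∧ a = K i
  | .inl ltSym' => ∃ i, p = 2 * (i + 1) + 1 ∧ K (i + 1) ≤ K i
  | .inl borderSym => ∃ i, p = 2 * i + 1 ∧ a = K 0
  | .inl borderKey => ∃ i, p = 2 * i ∧ a = K 0
  | .inl borderSym' => ∃ i, p = 2 * i + 1 ∧ K i ≠ K 0
  | .inl succSym₀ => ∃ i, p = 2 * i + 1 ∧ a = K i
  | .inl succKey₁ => ∃ i, p = 2 * (i + 1) ∧ a = K i
  | .inl succSym => ∃ i j, p = 2 * j + 1 ∧ i + 1 ≤ j ∧ a = K i ∧ b = K (i + 1)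
  | .inl succKey => ∃ i j, p = 2 * j ∧ i + 2 ≤ j ∧ a = K i ∧ b = K (i + 1)
  | .inl succSym' => ∃ i j, p = 2 * j + 1 ∧ i + 2 ≤ j ∧ K j = K i ∧ b = K (i + 1)
  | .inl succKey' => ∃ i j, p = 2 * (j + 1) ∧ i + 2 ≤ j ∧ K j = K i ∧ b = K (i + 1)
  | .inl leftSym => ∃ i, p = 2 * i + 1
  | .inl (middleKey l) => ∃ i, p = 2 * (i + 1) ∧ s i = l
  | .inl (middleSym l) => ∃ i, p = 2 * (i + 1) + 1 ∧ s i = l ∧ a = K (i + 1)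
  | .inl (rightKey l m) => ∃ i, p = 2 * (i + 2) ∧ s i = l ∧ s (i + 1) = m ∧ a = K (i + 1)
  | .inl (rightSym l m) => ∃ i, p = 2 * (i + 2) + 1 ∧ s i = l ∧ s (i + 1) = m ∧ a = K (i + 1)
  | .inl (belowKey l m r) => ∃ i j, p = 2 * j ∧ i + 3 ≤ j ∧ s i = l ∧ s (i + 1) = m ∧
      s (i + 2) = r ∧ a = K (i + 1) ∧ ∀ j', i + 3 ≤ j' → j' < j → K j' ≠ K (i + 1)
  | .inl (belowSym l m r) => ∃ i j, p = 2 * j + 1 ∧ i + 3 ≤ j ∧ s i = l ∧ s (i + 1) = m ∧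
      s (i + 2) = r ∧ a = K (i + 1) ∧ ∀ j', i + 3 ≤ j' → j' < j + 1 → K j' ≠ K (i + 1)
  | .inl (belowSym' l m r) => ∃ i j, p = 2 * j + 1 ∧ i + 3 ≤ j ∧ s i = l ∧ s (i + 1) = m ∧
      s (i + 2) = r ∧ K j = K (i + 1) ∧ ∀ j', i + 3 ≤ j' → j' < j → K j' ≠ K (i + 1)
  | .inl zeroSym => p = 1
  | .inl prefixKey => ∃ i, p = 2 * i ∧ 0 < i ∧ ∀ i', 0 < i' → i' < i → s i' = plain P.blank
  | .inl prefixSym => ∃ i, p = 2 * i + 1 ∧ 0 < i ∧ ∀ i', 0 < i' → i' < i → s i' = plain P.blank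
  | .inl sndKey => ∃ h, p = 2 * (h + 1) ∧ P.HeadAt s h
  | .inl sndSym => ∃ h, p = 2 * (h + 1) + 1 ∧ P.HeadAt s h
  | .inl suffixKey => ∃ h i, p = 2 * i ∧ P.HeadAt s h ∧ h + 2 + n ≤ i ∧
      ∀ i', h + 2 + n ≤ i' → i' < i → s i' = plain P.blank
  | .inl suffixSym => ∃ h i, p = 2 * i + 1 ∧ P.HeadAt s h ∧ h + 2 + n ≤ i ∧
      ∀ i', h + 2 + n ≤ i' → i' < i → s i' = plain P.blank
  | .inl haltKey => ∃ i, p = 2 * i ∧ ∀ i' < i, ¬ P.IsHalting (s i')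
  | .inl haltSym => ∃ i, p = 2 * i + 1 ∧ ∀ i' < i, ¬ P.IsHalting (s i')
  | .inr k => ∃ h, p + k = 2 * (h + 2 + n) ∧ P.HeadAt s h

end UnaryMachine

/-! ### Histories are not accepted -/

namespace UnaryMachine
open HelixState HelixTest
variable {Λ Γ : Type} {P : UnaryMachine Λ Γ}
variable {n N : ℕ} {v : HelixSym Λ Γ → ℚ} {x : ℕ → ℚ} {K : ℕ → ℚ} {s : ℕ → HelixSym Λ Γ}

theorem Invariant.exists_of_isInitial {p : ℕ} {a b : ℚ} {q : HelixState (HelixSym Λ Γ)}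
    (h : P.Invariant n K s p a b (.inl q)) (hq : q.IsInitial) : ∃ i, p = 2 * i := by
  rcases hq with rfl | rfl
  · exact ⟨0, h⟩
  · exact h

/-- The automaton sees no violation in a word that encodes a halting history. -/
theorem Run.invariant (H : P.IsHelix n N K s) (hv : Function.Injective v)
    (hK : ∀ i < N, x (2 * i) = K i) (hs : ∀ i < N, x (2 * i + 1) = v (s i))
    {p : ℕ} {q : HelixState (HelixSym Λ Γ) ⊕ ℕ} {a b : ℚ} (h : P.Run n v x p q a b)
    (hp : p ≤ 2 * N) : P.Invariant n K s p a b q := by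
  induction h with
  | zero => exact rfl
  | @succ p q a b t u q' _ htr ht ih =>
    replace ih := ih (by omega)
    cases htr with
    | base htr =>
      cases htr with
      | accept => exact ih.elim
      | skip_key hq =>
        obtain ⟨i, rfl⟩ := ih.exists_of_isInitial hq
        exact ⟨i, rfl⟩
      | skip_sym => obtain ⟨i, rfl⟩ := ih; exact ⟨i + 1, rfl⟩
      | skip_accept => obtain ⟨i, rfl⟩ := ih; exact ht _ (hs i (by omega))
      | lt_store hq =>
        obtain ⟨i, rfl⟩ := ih.exists_of_isInitial hq
        exact ⟨i, rfl, hK i (by omega)⟩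
      | lt_sym => obtain ⟨i, rfl, ha⟩ := ih; exact ⟨i, rfl, ha⟩
      | lt_key =>
        obtain ⟨i, rfl, rfl⟩ := ih
        refine ⟨i, rfl, ?_⟩
        rw [← hK (i + 1) (by omega)]
        exact ht
      | lt_accept =>
        obtain ⟨i, rfl, hle⟩ := ih
        refine (H.key_lt i (by omega) fun h0 => ht ?_).not_ge hle
        rw [hs _ (by omega), h0]; rfl
      | border_store =>
        obtain rfl : p = 0 := ih
        exact ⟨0, rfl, hK 0 (by omega)⟩
      | border_sym => obtain ⟨i, rfl, ha⟩ := ih; exact ⟨i + 1, rfl, ha⟩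
      | border_skip => obtain ⟨i, rfl, ha⟩ := ih; exact ⟨i, rfl, ha⟩
      | border_key =>
        obtain ⟨i, rfl, rfl⟩ := ih
        refine ⟨i, rfl, ?_⟩
        rw [← hK i (by omega)]
        exact ht
      | border_accept =>
        obtain ⟨i, rfl, hne⟩ := ih
        exact hne (H.border_key i (by omega) (hv ((hs i (by omega)).symm.trans ht)))
      | succ_store hq =>
        obtain ⟨i, rfl⟩ := ih.exists_of_isInitial hq
        exact ⟨i, rfl, hK i (by omega)⟩
      | succ_sym₀ => obtain ⟨i, rfl, ha⟩ := ih; exact ⟨i, rfl, ha⟩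
      | succ_key₁ =>
        obtain ⟨i, rfl, ha⟩ := ih
        exact ⟨i, i + 1, rfl, le_rfl, ha, hK (i + 1) (by omega)⟩
      | succ_sym =>
        obtain ⟨i, j, rfl, hij, ha, hb⟩ := ih
        exact ⟨i, j + 1, rfl, by omega, ha, hb⟩
      | succ_skip =>
        obtain ⟨i, j, rfl, hij, ha, hb⟩ := ih
        exact ⟨i, j, rfl, by omega, ha, hb⟩
      | succ_key =>
        obtain ⟨i, j, rfl, hij, rfl, hb⟩ := ih
        exact ⟨i, j, rfl, hij, (hK j (by omega)).symm.trans ht, hb⟩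
      | succ_sym' =>
        obtain ⟨i, j, rfl, hij, ha, hb⟩ := ih
        exact ⟨i, j, rfl, hij, ha, hb⟩
      | succ_accept =>
        obtain ⟨i, j, rfl, hij, ha, rfl⟩ := ih
        exact ht ((hK (j + 1) (by omega)).trans (H.key_succ i j hij (by omega) ha))
      | left_key hq =>
        obtain ⟨i, rfl⟩ := ih.exists_of_isInitial hq
        exact ⟨i, rfl⟩
      | left_sym l =>
        obtain ⟨i, rfl⟩ := ih
        exact ⟨i, rfl, hv ((hs i (by omega)).symm.trans ht)⟩
      | middle_key l =>
        obtain ⟨i, rfl, hl⟩ := ih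
        exact ⟨i, rfl, hl, hK (i + 1) (by omega)⟩
      | middle_sym l m =>
        obtain ⟨i, rfl, hl, ha⟩ := ih
        exact ⟨i, rfl, hl, hv ((hs (i + 1) (by omega)).symm.trans ht), ha⟩
      | right_key l m =>
        obtain ⟨i, rfl, hl, hm, ha⟩ := ih
        exact ⟨i, rfl, hl, hm, ha⟩
      | right_sym l m r =>
        obtain ⟨i, rfl, hl, hm, ha⟩ := ih
        exact ⟨i, i + 3, rfl, le_rfl, hl, hm, hv ((hs (i + 2) (by omega)).symm.trans ht), ha,
          fun j' h₁ h₂ => by omega⟩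
      | below_skip l m r =>
        obtain ⟨i, j, rfl, hij, hl, hm, hr, rfl, hne⟩ := ih
        refine ⟨i, j, rfl, hij, hl, hm, hr, rfl, fun j' h₁ h₂ => ?_⟩
        rcases Nat.lt_succ_iff_lt_or_eq.1 h₂ with h₂ | rfl
        · exact hne j' h₁ h₂
        · rw [← hK j' (by omega)]; exact ht
      | below_sym l m r =>
        obtain ⟨i, j, rfl, hij, hl, hm, hr, ha, hne⟩ := ih
        exact ⟨i, j + 1, rfl, by omega, hl, hm, hr, ha, hne⟩
      | below_key l m r =>
        obtain ⟨i, j, rfl, hij, hl, hm, hr, rfl, hne⟩ := ih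
        exact ⟨i, j, rfl, hij, hl, hm, hr, (hK j (by omega)).symm.trans ht, hne⟩
      | below_accept l m r d hd =>
        obtain ⟨i, j, rfl, hij, rfl, rfl, rfl, hj, hne⟩ := ih
        have := hv ((hs j (by omega)).symm.trans ht)
        exact hd (this ▸ H.allowed i j hij (by omega) hj hne)
      | zero_key =>
        obtain rfl : p = 0 := ih
        exact rfl
      | zero_accept =>
        obtain rfl : p = 1 := ih
        refine ht ((hs 0 (by omega)).trans ?_)
        rw [H.border_zero (by omega)]; rfl
      | zero_sym =>
        obtain rfl : p = 1 := ih
        exact ⟨1, rfl, one_pos, fun i' h₁ h₂ => by omega⟩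
      | prefix_key => obtain ⟨i, rfl, h⟩ := ih; exact ⟨i, rfl, h⟩
      | prefix_blank =>
        obtain ⟨i, rfl, h0, h⟩ := ih
        refine ⟨i + 1, rfl, by omega, fun i' h₁ h₂ => ?_⟩
        rcases Nat.lt_succ_iff_lt_or_eq.1 h₂ with h₂ | rfl
        · exact h i' h₁ h₂
        · exact hv ((hs i' (by omega)).symm.trans ht)
      | prefix_head =>
        obtain ⟨i, rfl, h0, h⟩ := ih
        exact ⟨i, rfl, h0, h, hv ((hs i (by omega)).symm.trans ht)⟩
      | prefix_accept d h₁ h₂ =>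
        obtain ⟨i, rfl, h0, h⟩ := ih
        have := hv ((hs i (by omega)).symm.trans ht)
        rcases H.prefix_blank i h0 (by omega) h with h | h
        · exact h₁ (this ▸ h)
        · exact h₂ (this ▸ h)
      | snd_key => obtain ⟨i, rfl, h⟩ := ih; exact ⟨i, rfl, h⟩
      | snd_accept =>
        obtain ⟨i, rfl, h0, h₁, h₂⟩ := ih
        refine ht ((hs (i + 1) (by omega)).trans ?_)
        rw [H.input_snd i h0 h₁ h₂ (by omega)]; rfl
      | suffix_key => obtain ⟨h, i, rfl, h'⟩ := ih; exact ⟨h, i, rfl, h'⟩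
      | suffix_sym =>
        obtain ⟨h, i, rfl, hh, hi, h'⟩ := ih
        refine ⟨h, i + 1, rfl, hh, by omega, fun i' h₁ h₂ => ?_⟩
        rcases Nat.lt_succ_iff_lt_or_eq.1 h₂ with h₂ | rfl
        · exact h' i' h₁ h₂
        · exact hv ((hs i' (by omega)).symm.trans ht)
      | suffix_accept d h₁ h₂ =>
        obtain ⟨h, i, rfl, ⟨hh, hh', hh''⟩, hi, h'⟩ := ih
        have := hv ((hs i (by omega)).symm.trans ht)
        rcases H.suffix_blank h hh hh' hh'' i hi (by omega) h' with h | h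
        · exact h₁ (this ▸ h)
        · exact h₂ (this ▸ h)
      | halt_zero =>
        obtain rfl : p = 0 := ih
        exact ⟨0, rfl, fun i h => by omega⟩
      | halt_sym d hd =>
        obtain ⟨i, rfl, h⟩ := ih
        refine ⟨i + 1, rfl, fun i' h₂ => ?_⟩
        rcases Nat.lt_succ_iff_lt_or_eq.1 h₂ with h₂ | rfl
        · exact h i' h₂
        · rw [hv ((hs i' (by omega)).symm.trans ht)]; exact hd
      | halt_key => obtain ⟨i, rfl, h⟩ := ih; exact ⟨i, rfl, h⟩
    | enter =>
      obtain ⟨h, rfl, hh⟩ := ih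
      exact ⟨h, by omega, hh⟩
    | count k hk =>
      obtain ⟨h, hp, hh⟩ := ih
      exact ⟨h, by omega, hh⟩
    | rest_accept j hj =>
      obtain ⟨h, hp, h0, h₁, h₂⟩ := ih
      refine ht ?_
      rw [show p = 2 * (h + 2 + (n - 1 - j)) + 1 by omega, hs _ (by omega),
        H.input_rest h h0 h₁ h₂ (n - 1 - j) (by omega) (by omega)]
      rfl
    | leave =>
      obtain ⟨h, hp, hh⟩ := ih
      exact ⟨h, h + 2 + n, by omega, hh, le_rfl, fun i' h₁ h₂ => by omega⟩

theorem IsHelix.not_accepts (H : P.IsHelix n N K s) (hv : Function.Injective v)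
    (hK : ∀ i < N, x (2 * i) = K i) (hs : ∀ i < N, x (2 * i + 1) = v (s i)) :
    ¬ P.Accepts n v x (2 * N) := by
  rintro ⟨q, a, b, hr, hq⟩
  have hi := hr.invariant H hv hK hs le_rfl
  obtain ⟨i₀, hi₀, hh⟩ := H.halting
  rcases hq with rfl | rfl | rfl | rfl
  · exact hi
  · have : 2 * N = 0 := hi
    omega
  · obtain ⟨i, hN, h⟩ := hi
    exact h i₀ (by omega) hh
  · obtain ⟨i, hN, h⟩ := hi
    omega

end UnaryMachine

/-! ### Words that are not accepted are histories -/

namespace UnaryMachine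
open HelixState HelixTest
variable {Λ Γ : Type} {P : UnaryMachine Λ Γ}
variable {n N : ℕ} {v : HelixSym Λ Γ → ℚ} {x : ℕ → ℚ} {s : ℕ → HelixSym Λ Γ}

theorem Run.accepts {p : ℕ} {a b : ℚ} (h : P.Run n v x p (.inl accept) a b) {m : ℕ} (hm : p ≤ m) :
    P.Accepts n v x m := by
  refine ⟨accept, a, b, ?_, .inl rfl⟩
  induction m, hm using Nat.le_induction with
  | base => exact h
  | succ m _ ih => exact ih.succ (.base .accept) trivial

variable (P n v x) in
theorem exists_run_isInitial (i : ℕ) :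
    ∃ q : HelixState (HelixSym Λ Γ), q.IsInitial ∧ P.Run n v x (2 * i) (.inl q) 0 0 := by
  induction i with
  | zero => exact ⟨initial, .inl rfl, .zero⟩
  | succ i ih =>
    obtain ⟨q, hq, h⟩ := ih
    have h₁ : P.Run n v x (2 * i + 1) (.inl skipSym) 0 0 := h.succ (.base (.skip_key hq)) trivial
    exact ⟨skipKey, .inr rfl, h₁.succ (.base .skip_sym) trivial⟩

/-! #### Conditions on words that are not accepted -/

section

variable {m : ℕ} (hx : ¬ P.Accepts n v x m)

include hx

/-- The first of the lemmas that derive one property of a history each from the fact that the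
automaton, which may take the path for a violation of this property, does not accept. -/
theorem exists_sym_of_not_accepts {i : ℕ} (hi : 2 * i + 2 ≤ m) : ∃ d, x (2 * i + 1) = v d := by
  by_contra! hne
  obtain ⟨q, hq, h⟩ := exists_run_isInitial P n v x i
  have h₁ : P.Run n v x (2 * i + 1) (.inl skipSym) 0 0 := h.succ (.base (.skip_key hq)) trivial
  exact hx ((h₁.succ (.base .skip_accept) hne).accepts hi)

variable (hN : 2 * N ≤ m) (hv : Function.Injective v) (hs : ∀ i < N, x (2 * i + 1) = v (s i))

include hN hs

omit hs in
theorem key_succ_of_not_accepts {i j : ℕ} (hij : i + 2 ≤ j) (hj : j + 1 < N)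
    (hK : x (2 * j) = x (2 * i)) : x (2 * (j + 1)) = x (2 * (i + 1)) := by
  by_contra hne
  obtain ⟨q, hq, h⟩ := exists_run_isInitial P n v x i
  have h₁ : P.Run n v x (2 * i + 1) (.inl succSym₀) (x (2 * i)) 0 :=
    h.succ (.base (.succ_store hq)) trivial
  have h₂ : P.Run n v x (2 * (i + 1)) (.inl succKey₁) (x (2 * i)) 0 :=
    h₁.succ (.base .succ_sym₀) trivial
  have h₃ : P.Run n v x (2 * (i + 1) + 1) (.inl succSym) (x (2 * i)) (x (2 * (i + 1))) :=
    h₂.succ (.base .succ_key₁) trivial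
  have h₄ : P.Run n v x (2 * j) (.inl succKey) (x (2 * i)) (x (2 * (i + 1))) := by
    clear hK hne hj
    induction j, hij using Nat.le_induction with
    | base => exact h₃.succ (.base .succ_sym) trivial
    | succ j _ ih =>
      have h₅ : P.Run n v x (2 * j + 1) (.inl succSym) (x (2 * i)) (x (2 * (i + 1))) :=
        ih.succ (.base .succ_skip) trivial
      exact h₅.succ (.base .succ_sym) trivial
  have h₅ : P.Run n v x (2 * j + 1) (.inl succSym') (x (2 * i)) (x (2 * (i + 1))) :=
    h₄.succ (.base .succ_key) hK
  have h₆ : P.Run n v x (2 * (j + 1)) (.inl succKey') (x (2 * i)) (x (2 * (i + 1))) :=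
    h₅.succ (.base .succ_sym') trivial
  exact hx ((h₆.succ (.base .succ_accept) hne).accepts (by omega))

theorem allowed_of_not_accepts {i j : ℕ} (hij : i + 3 ≤ j) (hj : j < N)
    (hK : x (2 * j) = x (2 * (i + 1)))
    (hne : ∀ j', i + 3 ≤ j' → j' < j → x (2 * j') ≠ x (2 * (i + 1))) :
    P.Allowed (s i) (s (i + 1)) (s (i + 2)) (s j) := by
  by_contra hA
  obtain ⟨q, hq, h⟩ := exists_run_isInitial P n v x i
  have h₁ : P.Run n v x (2 * i + 1) (.inl leftSym) 0 0 := h.succ (.base (.left_key hq)) trivial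
  have h₂ : P.Run n v x (2 * (i + 1)) (.inl (middleKey (s i))) 0 0 :=
    h₁.succ (.base (.left_sym _)) (hs i (by omega))
  have h₃ : P.Run n v x (2 * (i + 1) + 1) (.inl (middleSym (s i))) (x (2 * (i + 1))) 0 :=
    h₂.succ (.base (.middle_key _)) trivial
  have h₄ : P.Run n v x (2 * (i + 2)) (.inl (rightKey (s i) (s (i + 1)))) (x (2 * (i + 1))) 0 :=
    h₃.succ (.base (.middle_sym _ _)) (hs (i + 1) (by omega))
  have h₅ : P.Run n v x (2 * (i + 2) + 1) (.inl (rightSym (s i) (s (i + 1))))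
      (x (2 * (i + 1))) 0 := h₄.succ (.base (.right_key _ _)) trivial
  have h₆ : P.Run n v x (2 * j) (.inl (belowKey (s i) (s (i + 1)) (s (i + 2))))
      (x (2 * (i + 1))) 0 := by
    clear hK hA
    induction j, hij using Nat.le_induction with
    | base => exact h₅.succ (.base (.right_sym _ _ _)) (hs (i + 2) (by omega))
    | succ j hij ih =>
      have h₇ : P.Run n v x (2 * j + 1) (.inl (belowSym (s i) (s (i + 1)) (s (i + 2))))
          (x (2 * (i + 1))) 0 :=
        (ih (by omega) fun j' h₁ h₂ => hne j' h₁ (by omega)).succ (.base (.below_skip _ _ _))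
          (hne j hij (by omega))
      exact h₇.succ (.base (.below_sym _ _ _)) trivial
  have h₇ : P.Run n v x (2 * j + 1) (.inl (belowSym' (s i) (s (i + 1)) (s (i + 2))))
      (x (2 * (i + 1))) 0 := h₆.succ (.base (.below_key _ _ _)) hK
  exact hx ((h₇.succ (.base (.below_accept _ _ _ _ hA)) (hs j hj)).accepts (by omega))

include hv

theorem border_zero_of_not_accepts (h0 : 0 < N) : s 0 = none := by
  by_contra hne
  have h₁ : P.Run n v x 1 (.inl zeroSym) 0 0 := Run.zero.succ (.base .zero_key) trivial
  refine hx ((h₁.succ (.base .zero_accept) fun h => hne (hv ?_)).accepts (by omega))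
  rw [← hs 0 h0]; exact h

theorem key_lt_of_not_accepts {i : ℕ} (hi : i + 1 < N) (h0 : s (i + 1) ≠ none) :
    x (2 * i) < x (2 * (i + 1)) := by
  by_contra! hle
  obtain ⟨q, hq, h⟩ := exists_run_isInitial P n v x i
  have h₁ : P.Run n v x (2 * i + 1) (.inl ltSym) (x (2 * i)) 0 :=
    h.succ (.base (.lt_store hq)) trivial
  have h₂ : P.Run n v x (2 * (i + 1)) (.inl ltKey) (x (2 * i)) 0 :=
    h₁.succ (.base .lt_sym) trivial
  have h₃ : P.Run n v x (2 * (i + 1) + 1) (.inl ltSym') (x (2 * i)) 0 :=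
    h₂.succ (.base .lt_key) hle
  refine hx ((h₃.succ (.base .lt_accept) fun h => h0 (hv ?_)).accepts (by omega))
  rw [← hs _ hi]; exact h

omit hv in
theorem border_key_of_not_accepts {i : ℕ} (hi : i < N) (h0 : s i = none) :
    x (2 * i) = x 0 := by
  by_contra hne
  have h₁ (j : ℕ) : P.Run n v x (2 * (j + 1)) (.inl borderKey) (x 0) 0 := by
    induction j with
    | zero =>
      have h₁ : P.Run n v x 1 (.inl borderSym) (x 0) 0 :=
        Run.zero.succ (.base .border_store) trivial
      exact h₁.succ (.base .border_sym) trivial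
    | succ j ih =>
      have h₁ : P.Run n v x (2 * (j + 1) + 1) (.inl borderSym) (x 0) 0 :=
        ih.succ (.base .border_skip) trivial
      exact h₁.succ (.base .border_sym) trivial
  obtain ⟨j, rfl⟩ : ∃ j, i = j + 1 := Nat.exists_eq_succ_of_ne_zero fun h => hne (by rw [h])
  have h₂ : P.Run n v x (2 * (j + 1) + 1) (.inl borderSym') (x 0) 0 :=
    (h₁ j).succ (.base .border_key) hne
  refine hx ((h₂.succ (.base .border_accept) ?_).accepts (by omega))
  rw [hs _ hi, h0]; rfl

omit hv hx hN in
theorem run_prefixSym {i : ℕ} (h0 : 0 < i) (hi : i < N)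
    (hb : ∀ i', 0 < i' → i' < i → s i' = plain P.blank) :
    P.Run n v x (2 * i + 1) (.inl prefixSym) 0 0 := by
  induction i, h0 using Nat.le_induction with
  | base =>
    have h₁ : P.Run n v x 1 (.inl zeroSym) 0 0 := Run.zero.succ (.base .zero_key) trivial
    have h₂ : P.Run n v x 2 (.inl prefixKey) 0 0 := h₁.succ (.base .zero_sym) trivial
    exact h₂.succ (.base .prefix_key) trivial
  | succ i h0 ih =>
    have h₁ : P.Run n v x (2 * (i + 1)) (.inl prefixKey) 0 0 :=
      (ih (by omega) fun i' h₁ h₂ => hb i' h₁ (by omega)).succ (.base .prefix_blank)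
        ((hs i (by omega)).trans (by rw [hb i h0 (by omega)]; rfl))
    exact h₁.succ (.base .prefix_key) trivial

omit hv in
theorem prefix_blank_of_not_accepts {i : ℕ} (h0 : 0 < i) (hi : i < N)
    (hb : ∀ i', 0 < i' → i' < i → s i' = plain P.blank) :
    s i = plain P.blank ∨ s i = some (some P.start, P.fst) := by
  by_contra! hne
  exact hx (((run_prefixSym hs h0 hi hb).succ (.base (.prefix_accept _ hne.1 hne.2))
    (hs i hi)).accepts (by omega))

omit hv hx hN in
theorem run_sndSym {h : ℕ} (hh : P.HeadAt s h) (hi : h < N) :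
    P.Run n v x (2 * (h + 1) + 1) (.inl sndSym) 0 0 := by
  have h₁ : P.Run n v x (2 * (h + 1)) (.inl sndKey) 0 0 :=
    (run_prefixSym hs hh.1 hi hh.2.1).succ (.base .prefix_head)
      ((hs h hi).trans (by rw [hh.2.2]; rfl))
  exact h₁.succ (.base .snd_key) trivial

theorem input_snd_of_not_accepts {h : ℕ} (hh : P.HeadAt s h) (hi : h + 1 < N) :
    s (h + 1) = plain P.snd := by
  by_contra hne
  refine hx (((run_sndSym hs hh (by omega)).succ (.base .snd_accept)
    fun h => hne (hv ?_)).accepts (by omega))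
  rw [← hs _ hi]; exact h

omit hv hx hN in
theorem run_count {h : ℕ} (hh : P.HeadAt s h) (hi : h < N) {k l : ℕ} (hkl : k + l = 2 * n) :
    P.Run n v x (2 * (h + 2) + l) (.inr k) 0 0 := by
  induction l generalizing k with
  | zero =>
    obtain rfl : k = 2 * n := hkl
    exact (run_sndSym hs hh hi).succ .enter trivial
  | succ l ih =>
    exact (ih (show k + 1 + l = 2 * n by omega)).succ (.count k (by omega)) trivial

theorem input_rest_of_not_accepts {h : ℕ} (hh : P.HeadAt s h) {j : ℕ} (hj : j < n)
    (hi : h + 2 + j < N) : s (h + 2 + j) = plain P.rest := by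
  by_contra hne
  have h₁ := run_count hs hh (by omega)
    (show (2 * (n - 1 - j) + 1) + (2 * j + 1) = 2 * n by omega)
  refine hx ((h₁.succ (.rest_accept _ (by omega)) fun h => hne (hv ?_)).accepts (by omega))
  rw [← hs _ hi]
  rw [← add_assoc, ← mul_add] at h
  exact h

omit hv in
theorem suffix_blank_of_not_accepts {h : ℕ} (hh : P.HeadAt s h) {i : ℕ} (hi : h + 2 + n ≤ i)
    (hiN : i < N) (hb : ∀ i', h + 2 + n ≤ i' → i' < i → s i' = plain P.blank) :
    s i = plain P.blank ∨ s i = none := by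
  by_contra! hne
  have h₁ : P.Run n v x (2 * i + 1) (.inl suffixSym) 0 0 := by
    clear hne
    induction i, hi using Nat.le_induction with
    | base =>
      have h₁ := run_count hs hh (by omega) (Nat.zero_add (2 * n))
      rw [← mul_add] at h₁
      exact h₁.succ .leave trivial
    | succ i hi ih =>
      have h₁ : P.Run n v x (2 * (i + 1)) (.inl suffixKey) 0 0 :=
        (ih (by omega) fun i' h₁ h₂ => hb i' h₁ (by omega)).succ (.base .suffix_sym)
          ((hs i (by omega)).trans (by rw [hb i hi (by omega)]; rfl))
      exact h₁.succ (.base .suffix_key) trivial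
  exact hx ((h₁.succ (.base (.suffix_accept _ hne.1 hne.2)) (hs i hiN)).accepts (by omega))

omit hv hN in
theorem halting_of_not_accepts (hm : m = 2 * N ∨ m = 2 * N + 1) :
    ∃ i < N, P.IsHalting (s i) := by
  by_contra! hne
  have h₁ (i : ℕ) (hi : i ≤ N) : P.Run n v x (2 * i + 1) (.inl haltSym) 0 0 := by
    induction i with
    | zero => exact Run.zero.succ (.base .halt_zero) trivial
    | succ i ih =>
      have h₁ : P.Run n v x (2 * (i + 1)) (.inl haltKey) 0 0 :=
        (ih (by omega)).succ (.base (.halt_sym _ (hne i hi))) (hs i hi)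
      exact h₁.succ (.base .halt_key) trivial
  refine hx ?_
  rcases hm with rfl | rfl
  · rcases N with _ | N
    · exact ⟨_, _, _, .zero, .inr (.inl rfl)⟩
    · exact ⟨_, _, _, (h₁ N (by omega)).succ (.base (.halt_sym _ (hne N (by omega))))
        (hs N (by omega)), .inr (.inr (.inl rfl))⟩
  · exact ⟨_, _, _, h₁ N le_rfl, .inr (.inr (.inr rfl))⟩

end

/-- Only histories are not accepted. -/
theorem exists_isHelix_of_not_accepts (hv : Function.Injective v) {m : ℕ}
    (hx : ¬ P.Accepts n v x m) : ∃ s, P.IsHelix n (m / 2) (fun i => x (2 * i)) s := by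
  have hN : 2 * (m / 2) ≤ m := Nat.mul_div_le m 2
  have : ∀ i, ∃ d, i < m / 2 → x (2 * i + 1) = v d := by
    intro i
    by_cases hi : i < m / 2
    · obtain ⟨d, hd⟩ := exists_sym_of_not_accepts hx (show 2 * i + 2 ≤ m by omega)
      exact ⟨d, fun _ => hd⟩
    · exact ⟨none, fun h => absurd h hi⟩
  choose s hs using this
  exact ⟨s, {
    border_zero := border_zero_of_not_accepts hx hN hv hs
    key_lt := fun i hi h0 => key_lt_of_not_accepts hx hN hv hs hi h0
    border_key := fun i hi h0 => border_key_of_not_accepts hx hN hs hi h0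
    key_succ := fun i j hij hj hK => key_succ_of_not_accepts hx hN hij hj hK
    allowed := fun i j hij hj hK hne => allowed_of_not_accepts hx hN hs hij hj hK hne
    prefix_blank := fun i h0 hi hb => prefix_blank_of_not_accepts hx hN hs h0 hi hb
    input_snd := fun h h0 hb hh hi => input_snd_of_not_accepts hx hN hv hs ⟨h0, hb, hh⟩ hi
    input_rest := fun h h0 hb hh j hj hi =>
      input_rest_of_not_accepts hx hN hv hs ⟨h0, hb, hh⟩ hj hi
    suffix_blank := fun h h0 hb hh i hi hiN hb' =>
      suffix_blank_of_not_accepts hx hN hs ⟨h0, hb, hh⟩ hi hiN hb'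
    halting := halting_of_not_accepts hx hs (by omega) }⟩

end UnaryMachine

/-! ### The automaton as a register automaton -/

theorem Guard.holds_map {V W : Type} (f : V → W) (ν : W → ℚ) (φ : Guard V) :
    (φ.map f).Holds ν ↔ φ.Holds (ν ∘ f) := by
  induction φ with
  | le i j => rfl
  | neg φ ih => exact not_congr ih
  | and φ ψ ih₁ ih₂ => exact and_congr ih₁ ih₂
  | or φ ψ ih₁ ih₂ => exact or_congr ih₁ ih₂

theorem RAQ.reaches_append_singleton {Q X Y : Type} [Fintype X] [Fintype Y] (𝒜 : RAQ Q X Y)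
    (w : List ℚ) (d : ℚ) (c c' : RAQConfig Q X Y) :
    𝒜.Reaches (w ++ [d]) c c' ↔ ∃ c₁, 𝒜.Reaches w c c₁ ∧ ∃ t ∈ 𝒜.trans, t.Entails d c₁ c' := by
  induction w generalizing c with
  | nil => simp [RAQ.Reaches]
  | cons d' w ih =>
    simp only [List.cons_append, RAQ.Reaches, ih]
    constructor
    · rintro ⟨c₁, h₁, c₂, h₂, h₃⟩
      exact ⟨c₂, ⟨c₁, h₁, h₂⟩, h₃⟩
    · rintro ⟨c₂, ⟨c₁, h₁, h₂⟩, h₃⟩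
      exact ⟨c₁, h₁, c₂, h₂, h₃⟩

namespace UnaryMachine

variable {Λ Γ : Type} [Fintype Λ] [Fintype Γ] (P : UnaryMachine Λ Γ)
variable {m M : ℕ} (σ : HelixSym Λ Γ ≃ Fin m) (e : HelixState (HelixSym Λ Γ) ≃ Fin M)

/-- The letter that stands for a symbol is its number. -/
def letter (d : HelixSym Λ Γ) : ℚ := ((σ d : ℕ) : ℚ)

/-- The numbers of the states: the named states come first. -/
def stateNum : HelixState (HelixSym Λ Γ) ⊕ ℕ → ℕ
  | .inl q => e q
  | .inr k => M + k

/-- The numbers of the registers. The current letter has the number `m + 2`. -/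
def regNum : HelixReg (HelixSym Λ Γ) → ℕ
  | .sym d => σ d
  | .fst => m
  | .snd => m + 1

/-- The tests, as linear constraints. -/
def testGuard : HelixTest (HelixSym Λ Γ) → Guard ℕ
  | .any => .le 0 0
  | .eq r => .and (.le (m + 2) (regNum σ r)) (.le (regNum σ r) (m + 2))
  | .ne r => .neg (.and (.le (m + 2) (regNum σ r)) (.le (regNum σ r) (m + 2)))
  | .le r => .le (m + 2) (regNum σ r)
  | .invalid => (List.range m).foldr
      (fun i φ => .and (.neg (.and (.le (m + 2) i) (.le i (m + 2)))) φ) (.le 0 0)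

variable (m) in
/-- The assignments to the registers, as lists of numbers. -/
def updateList : HelixUpdate → List ℕ
  | .keep => []
  | .fst => List.range m ++ [m + 2]
  | .snd => List.range (m + 1) ++ [m + 2]

/-- The description of a transition. -/
def transCode (q : HelixState (HelixSym Λ Γ) ⊕ ℕ) (t : HelixTest (HelixSym Λ Γ)) (u : HelixUpdate)
    (q' : HelixState (HelixSym Λ Γ) ⊕ ℕ) : TransitionCode :=
  ⟨stateNum e q, testGuard σ t, stateNum e q', updateList m u, [], []⟩

/-- The descriptions of the transitions between the named states. -/
noncomputable def baseCodes : List TransitionCode :=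
  ((Set.toFinite {p : HelixState (HelixSym Λ Γ) × HelixTest (HelixSym Λ Γ) × HelixUpdate ×
      HelixState (HelixSym Λ Γ) | P.BaseTrans p.1 p.2.1 p.2.2.1 p.2.2.2}).toFinset.toList).map
    fun p => transCode σ e (.inl p.1) p.2.1 p.2.2.1 (.inl p.2.2.2)

/-- The descriptions of all transitions for the input with number `n`. -/
noncomputable def transCodes (n : ℕ) : List TransitionCode :=
  P.baseCodes σ e ++ (transCode σ e (.inl .sndSym) .any .keep (.inr (2 * n)) ::
    transCode σ e (.inr 0) .any .keep (.inl .suffixSym) ::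
    ((List.range (2 * n)).map (fun k => transCode σ e (.inr (k + 1)) .any .keep (.inr k)) ++
      (List.range n).map fun j =>
        transCode σ e (.inr (2 * j + 1)) (.ne (.sym (plain P.rest))) .keep (.inl .accept)))

/-- The description of the automaton that looks for violations of the conditions on histories of
the machine on the input with number `n`. Its only output is `0`. -/
noncomputable def code (n : ℕ) : RAQCode where
  numStates := M + 2 * n
  numCtrl := m + 2
  numData := 0
  start := stateNum e (.inl .initial)
  final := [stateNum e (.inl .accept), stateNum e (.inl .initial), stateNum e (.inl .haltKey),
    stateNum e (.inl .haltSym)]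
  initial := (List.range m).map fun i : ℕ => ((i : ℤ), 0)
  trans := P.transCodes σ e n
  out := []

theorem mem_transCodes_iff (n : ℕ) (s : TransitionCode) : s ∈ P.transCodes σ e n ↔
    ∃ q t u q', P.Trans n q t u q' ∧ s = transCode σ e q t u q' := by
  simp only [transCodes, baseCodes, List.mem_append, List.mem_map, Finset.mem_toList,
    Set.Finite.mem_toFinset, Set.mem_ofPred_eq, List.mem_cons, List.mem_range]
  constructor
  · rintro (⟨⟨q, t, u, q'⟩, h, rfl⟩ | rfl | rfl | ⟨k, hk, rfl⟩ | ⟨j, hj, rfl⟩)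
    · exact ⟨_, _, _, _, .base h, rfl⟩
    · exact ⟨_, _, _, _, .enter, rfl⟩
    · exact ⟨_, _, _, _, .leave, rfl⟩
    · exact ⟨_, _, _, _, .count k hk, rfl⟩
    · exact ⟨_, _, _, _, .rest_accept j hj, rfl⟩
  · rintro ⟨q, t, u, q', h, rfl⟩
    cases h with
    | @base q t u q' h => exact .inl ⟨(q, t, u, q'), h, rfl⟩
    | enter => exact .inr (.inl rfl)
    | leave => exact .inr (.inr (.inl rfl))
    | count k hk => exact .inr (.inr (.inr (.inl ⟨k, hk, rfl⟩)))
    | rest_accept j hj => exact .inr (.inr (.inr (.inr ⟨j, hj, rfl⟩)))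

omit [Fintype Λ] [Fintype Γ] in
theorem letter_injective : Function.Injective (letter σ) := fun _ _ h =>
  σ.injective (Fin.ext (Nat.cast_injective h))

omit [Fintype Λ] [Fintype Γ] in
theorem stateNum_injective : Function.Injective (stateNum e) := by
  rintro (q | k) (q' | k') h
  · exact congrArg _ (e.injective (Fin.ext h))
  · have h : (e q : ℕ) = M + k' := h
    omega
  · have h : M + k = (e q' : ℕ) := h
    omega
  · have h : M + k = M + k' := h
    rw [show k = k' by omega]

omit [Fintype Λ] [Fintype Γ] in
theorem stateNum_inl_lt (q : HelixState (HelixSym Λ Γ)) (n : ℕ) :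
    stateNum e (.inl q) < M + 2 * n + 1 := by
  have := (e q).2
  simp only [stateNum]
  omega

omit [Fintype Λ] [Fintype Γ] in
variable {P} in
theorem Trans.stateNum_lt {n : ℕ} {q t u q'} (h : P.Trans n q t u q') :
    stateNum e q < M + 2 * n + 1 ∧ stateNum e q' < M + 2 * n + 1 := by
  cases h with
  | base h => exact ⟨stateNum_inl_lt e _ n, stateNum_inl_lt e _ n⟩
  | enter => exact ⟨stateNum_inl_lt e _ n, by simp only [stateNum]; omega⟩
  | leave => exact ⟨by simp only [stateNum]; omega, stateNum_inl_lt e _ n⟩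
  | count k hk => exact ⟨by simp only [stateNum]; omega, by simp only [stateNum]; omega⟩
  | rest_accept j hj => exact ⟨by simp only [stateNum]; omega, stateNum_inl_lt e _ n⟩

variable (m) in
/-- The contents of the registers when `a` and `b` are the stored keys. -/
def regs (a b : ℚ) (i : Fin (m + 2)) : ℚ :=
  if (i : ℕ) < m then (i : ℕ) else if (i : ℕ) = m then a else b

/-- The valuation of the numbered registers. -/
theorem curVal_regs_varOf (a b d : ℚ) (i : ℕ) :
    curVal (regs m a b) d (varOf (m + 2) i) =
      if i < m then (i : ℚ) else if i = m then a else if i = m + 1 then b else d := by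
  unfold varOf
  split_ifs <;> simp_all [curVal, regs] <;> omega

omit [Fintype Λ] [Fintype Γ] in
theorem curVal_regs_regNum (a b d : ℚ) (r : HelixReg (HelixSym Λ Γ)) :
    curVal (regs m a b) d (varOf (m + 2) (regNum σ r)) = r.val (letter σ) a b := by
  rw [curVal_regs_varOf]
  cases r with
  | sym d => rw [regNum, if_pos (σ d).2]; rfl
  | fst => simp [regNum, HelixReg.val]
  | snd => simp [regNum, HelixReg.val]

omit [Fintype Λ] [Fintype Γ] in
theorem holds_testGuard_iff (a b d : ℚ) (t : HelixTest (HelixSym Λ Γ)) :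
    ((testGuard σ t).map (varOf (m + 2))).Holds (curVal (regs m a b) d) ↔
      t.Holds (letter σ) a b d := by
  have hcur : curVal (regs m a b) d (varOf (m + 2) (m + 2)) = d := by
    rw [curVal_regs_varOf]; simp
  have hr := curVal_regs_regNum σ a b d
  rw [Guard.holds_map]
  cases t with
  | any => simp [testGuard, Guard.Holds, HelixTest.Holds]
  | eq r => simp only [testGuard, Guard.Holds, HelixTest.Holds, Function.comp_apply, hcur, hr,
      le_antisymm_iff]
  | ne r => simp only [testGuard, Guard.Holds, HelixTest.Holds, Function.comp_apply, hcur, hr,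
      le_antisymm_iff, ne_eq]
  | le r => simp only [testGuard, Guard.Holds, HelixTest.Holds, Function.comp_apply, hcur, hr]
  | invalid =>
    have hfold (L : List ℕ) (hL : ∀ i ∈ L, i < m) :
        Guard.Holds (curVal (regs m a b) d ∘ varOf (m + 2)) (L.foldr
          (fun i φ => .and (.neg (.and (.le (m + 2) i) (.le i (m + 2)))) φ) (.le 0 0)) ↔
        ∀ i ∈ L, d ≠ (i : ℚ) := by
      induction L with
      | nil => simp [Guard.Holds]
      | cons i L ih =>
        rw [List.forall_mem_cons] at hL
        have hi : curVal (regs m a b) d (varOf (m + 2) i) = (i : ℚ) := by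
          rw [curVal_regs_varOf, if_pos hL.1]
        simp only [List.foldr_cons, Guard.Holds, ih hL.2, Function.comp_apply, hcur, hi,
          List.forall_mem_cons, ← le_antisymm_iff, ne_eq]
    rw [testGuard, hfold _ fun i hi => List.mem_range.1 hi]
    constructor
    · intro h d'
      exact h (σ d') (List.mem_range.2 (σ d').2)
    · intro h i hi
      have := h (σ.symm ⟨i, List.mem_range.1 hi⟩)
      rwa [letter, Equiv.apply_symm_apply] at this

theorem curVal_regs_updateList (a b d : ℚ) (u : HelixUpdate) (i : Fin (m + 2)) :
    curVal (regs m a b) d (varOf (m + 2) ((updateList m u).getD i i)) =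
      regs m (u.newFst a d) (u.newSnd b d) i := by
  have hi := i.2
  rw [curVal_regs_varOf]
  have hrange (k : ℕ) : (List.range k ++ [m + 2]).getD i i =
      if (i : ℕ) = k then m + 2 else i := by
    rw [List.getD_eq_getElem?_getD, List.getElem?_append]
    split_ifs with h₁ h₂ h₂
    · simp at h₁; omega
    · simp at h₁; simp [h₁]
    · simp [h₂]
    · simp at h₁
      rw [List.getElem?_eq_none (by simp; omega)]; rfl
  cases u with
  | keep =>
    change (if (i : ℕ) < m then ((i : ℕ) : ℚ) else if (i : ℕ) = m then a
      else if (i : ℕ) = m + 1 then b else d) = if (i : ℕ) < m then ((i : ℕ) : ℚ)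
      else if (i : ℕ) = m then a else b
    split_ifs <;> first | rfl | omega
  | fst =>
    simp only [updateList, hrange, regs, HelixUpdate.newFst, HelixUpdate.newSnd]
    split_ifs <;> first | rfl | omega
  | snd =>
    simp only [updateList, hrange, regs, HelixUpdate.newFst, HelixUpdate.newSnd]
    split_ifs <;> first | rfl | omega

/-- The configuration of the coded automaton that corresponds to a state and two stored keys. -/
def config (n : ℕ) (q : HelixState (HelixSym Λ Γ) ⊕ ℕ) (a b : ℚ) :
    RAQConfig (Fin (M + 2 * n + 1)) (Fin (m + 2)) (Fin 0) :=
  ⟨Fin.ofNat _ (stateNum e q), regs m a b, fun i => i.elim0⟩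

omit [Fintype Λ] [Fintype Γ] in
theorem eq_of_ofNat_stateNum {n : ℕ} {q q' : HelixState (HelixSym Λ Γ) ⊕ ℕ}
    (hq : stateNum e q < M + 2 * n + 1) (hq' : stateNum e q' < M + 2 * n + 1)
    (h : Fin.ofNat (M + 2 * n + 1) (stateNum e q) = Fin.ofNat _ (stateNum e q')) : q = q' := by
  have := congrArg Fin.val h
  simp only [Fin.ofNat, Nat.mod_eq_of_lt hq, Nat.mod_eq_of_lt hq'] at this
  exact stateNum_injective e this

omit [Fintype Λ] [Fintype Γ] in
/-- The bounds on the numbers of the states are needed because `RAQCode.toRAQ` reads them modulo the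
number of states. -/
theorem entails_transCode_iff (n : ℕ) {q₁ q q' : HelixState (HelixSym Λ Γ) ⊕ ℕ}
    (t : HelixTest (HelixSym Λ Γ)) (u : HelixUpdate) (a b d : ℚ)
    (hq₁ : stateNum e q₁ < M + 2 * n + 1) (hq : stateNum e q < M + 2 * n + 1)
    (c : RAQConfig (Fin (M + 2 * n + 1)) (Fin (m + 2)) (Fin 0)) :
    ((transCode σ e q t u q').toTransition (M + 2 * n) (m + 2) 0).Entails d (config e n q₁ a b) c ↔
      q₁ = q ∧ t.Holds (letter σ) a b d ∧
        c = config e n q' (u.newFst a d) (u.newSnd b d) := by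
  obtain ⟨p, y, z⟩ := c
  constructor
  · rintro ⟨h₁, h₂, h₃, h₄, -⟩
    refine ⟨eq_of_ofNat_stateNum e hq₁ hq h₁, (holds_testGuard_iff σ a b d t).1 h₃, ?_⟩
    rw [config, RAQConfig.mk.injEq]
    exact ⟨h₂, funext fun i => (h₄ i).trans (curVal_regs_updateList a b d u i),
      Subsingleton.elim _ _⟩
  · rintro ⟨rfl, h, hc⟩
    rw [hc]
    exact ⟨rfl, rfl, (holds_testGuard_iff σ a b d t).2 h,
      fun i => (curVal_regs_updateList a b d u i).symm, Subsingleton.elim _ _⟩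

theorem initConfig_code (n : ℕ) :
    (P.code σ e n).toRAQ.initConfig = config e n (.inl .initial) 0 0 := by
  rw [RAQ.initConfig, config]
  congr 1
  · funext i
    change ratEntry ((List.range m).map fun i : ℕ => ((i : ℤ), 0)) i = regs m 0 0 i
    unfold ratEntry regs
    rw [List.getD_eq_getElem?_getD, List.getElem?_map]
    split_ifs with h
    · simp [h, RatCode.val]
    · rw [List.getElem?_eq_none (by simpa using h)]; simp [RatCode.val]
    · rw [List.getElem?_eq_none (by simpa using h)]; simp [RatCode.val]
  · exact funext fun i => Fin.elim0 i

variable {P} in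
omit [Fintype Λ] [Fintype Γ] in
theorem Run.stateNum_lt {n p : ℕ} {v x q a b} (h : P.Run n v x p q a b) :
    stateNum e q < M + 2 * n + 1 := by
  cases h with
  | zero => exact stateNum_inl_lt e _ n
  | succ _ h _ => exact (h.stateNum_lt e).2

theorem reaches_code_iff (n : ℕ) (w : List ℚ) {p : ℕ} (hp : p ≤ w.length)
    (c : RAQConfig (Fin (M + 2 * n + 1)) (Fin (m + 2)) (Fin 0)) :
    (P.code σ e n).toRAQ.Reaches (w.take p) (P.code σ e n).toRAQ.initConfig c ↔
      ∃ q a b, P.Run n (letter σ) (w.getD · 0) p q a b ∧ c = config e n q a b := by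
  induction p generalizing c with
  | zero =>
    rw [initConfig_code, List.take_zero]
    constructor
    · intro h
      exact ⟨_, _, _, .zero, Eq.symm h⟩
    · rintro ⟨q, a, b, h, rfl⟩
      cases h
      rfl
  | succ p ih =>
    have hd : w.take (p + 1) = w.take p ++ [w.getD p 0] := by
      rw [List.take_succ_eq_append_getElem hp, List.getD_eq_getElem _ _ hp]
    rw [hd]
    refine (RAQ.reaches_append_singleton _ _ _ _ _).trans ?_
    constructor
    · rintro ⟨c₁, h₁, _, ⟨s, hs, rfl⟩, h₂⟩
      obtain ⟨q, a, b, hr, rfl⟩ := (ih (by omega) c₁).1 h₁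
      obtain ⟨q₁, t, u, q', ht, rfl⟩ := (P.mem_transCodes_iff σ e n s).1 hs
      obtain ⟨rfl, h, rfl⟩ := (entails_transCode_iff σ e n t u a b _ (hr.stateNum_lt e)
        (ht.stateNum_lt e).1 c).1 h₂
      exact ⟨_, _, _, hr.succ ht h, rfl⟩
    · rintro ⟨q', a', b', h, rfl⟩
      cases h with
      | succ hr ht h =>
        exact ⟨_, (ih (by omega) _).2 ⟨_, _, _, hr, rfl⟩, _,
          ⟨_, (P.mem_transCodes_iff σ e n _).2 ⟨_, _, _, _, ht, rfl⟩, rfl⟩,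
          (entails_transCode_iff σ e n _ _ _ _ _ (hr.stateNum_lt e)
            (ht.stateNum_lt e).1 _).2 ⟨rfl, h, rfl⟩⟩

theorem mem_outputs_code_iff (n : ℕ) (w : List ℚ) (r : ℚ) : r ∈ (P.code σ e n).toRAQ.outputs w ↔
    r = 0 ∧ P.Accepts n (letter σ) (w.getD · 0) w.length := by
  have hout (q : Fin (M + 2 * n + 1)) (y : Fin (m + 2) → ℚ) (z : Fin 0 → ℚ) :
      ((P.code σ e n).toRAQ.out q).eval y z = 0 := by
    have : ∀ i, ratEntry [] i = 0 := fun i => by simp [ratEntry, RatCode.val]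
    change (outputOf (m + 2) 0 ([], (0, 0))).eval y z = 0
    simp [RAQOutput.eval, outputOf, this, RatCode.val, dotProduct]
  have hreach := P.reaches_code_iff σ e n w le_rfl
  rw [List.take_length] at hreach
  constructor
  · rintro ⟨c, hc, hf, rfl⟩
    obtain ⟨q, a, b, hr, rfl⟩ := (hreach c).1 hc
    refine ⟨hout _ _ _, ?_⟩
    obtain ⟨s, hs, hq⟩ := hf
    have hq' : ∃ q' : HelixState (HelixSym Λ Γ), q'.IsFinal ∧ q = .inl q' := by
      simp only [code, List.mem_cons, List.not_mem_nil, or_false] at hs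
      rcases hs with rfl | rfl | rfl | rfl
      · exact ⟨_, .inl rfl,
          eq_of_ofNat_stateNum e (hr.stateNum_lt e) (stateNum_inl_lt e _ n) hq⟩
      · exact ⟨_, .inr (.inl rfl),
          eq_of_ofNat_stateNum e (hr.stateNum_lt e) (stateNum_inl_lt e _ n) hq⟩
      · exact ⟨_, .inr (.inr (.inl rfl)),
          eq_of_ofNat_stateNum e (hr.stateNum_lt e) (stateNum_inl_lt e _ n) hq⟩
      · exact ⟨_, .inr (.inr (.inr rfl)),
          eq_of_ofNat_stateNum e (hr.stateNum_lt e) (stateNum_inl_lt e _ n) hq⟩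
    obtain ⟨q', hq', rfl⟩ := hq'
    exact ⟨q', a, b, hr, hq'⟩
  · rintro ⟨rfl, q, a, b, hr, hq⟩
    refine ⟨_, (hreach _).2 ⟨_, _, _, hr, rfl⟩, ?_, (hout _ _ _).symm⟩
    refine ⟨stateNum e (.inl q), ?_, rfl⟩
    simp only [code]
    rcases hq with rfl | rfl | rfl | rfl <;> simp

end UnaryMachine

/-! ### The reduction from the halting problem -/

theorem TransitionCode.primrec_mk {α : Type} [Primcodable α] {f₁ : α → ℕ} {f₂ : α → Guard ℕ}
    {f₃ : α → ℕ} {f₄ : α → List ℕ} {f₅ : α → List (List RatCode)} {f₆ : α → List RatCode}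
    (h₁ : Primrec f₁) (h₂ : Primrec f₂) (h₃ : Primrec f₃) (h₄ : Primrec f₄) (h₅ : Primrec f₅)
    (h₆ : Primrec f₆) :
    Primrec fun a => TransitionCode.mk (f₁ a) (f₂ a) (f₃ a) (f₄ a) (f₅ a) (f₆ a) :=
  (Primrec.of_equiv_iff TransitionCode.equivProd).1
    (h₁.pair (h₂.pair (h₃.pair (h₄.pair (h₅.pair h₆)))))

theorem RAQCode.primrec_mk {α : Type} [Primcodable α] {f₁ f₂ f₃ f₄ : α → ℕ} {f₅ : α → List ℕ}
    {f₆ : α → List RatCode} {f₇ : α → List TransitionCode}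
    {f₈ : α → List (List RatCode × RatCode)} (h₁ : Primrec f₁) (h₂ : Primrec f₂) (h₃ : Primrec f₃)
    (h₄ : Primrec f₄) (h₅ : Primrec f₅) (h₆ : Primrec f₆) (h₇ : Primrec f₇) (h₈ : Primrec f₈) :
    Primrec fun a => RAQCode.mk (f₁ a) (f₂ a) (f₃ a) (f₄ a) (f₅ a) (f₆ a) (f₇ a) (f₈ a) :=
  (Primrec.of_equiv_iff RAQCode.equivProd).1
    (h₁.pair (h₂.pair (h₃.pair (h₄.pair (h₅.pair (h₆.pair (h₇.pair h₈)))))))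

namespace UnaryMachine

variable {Λ Γ : Type} [Fintype Λ] [Fintype Γ] (P : UnaryMachine Λ Γ)
variable {m M : ℕ} (σ : HelixSym Λ Γ ≃ Fin m) (e : HelixState (HelixSym Λ Γ) ≃ Fin M)

omit [Fintype Λ] [Fintype Γ] in
theorem primrec_transCode {α : Type} [Primcodable α] {q q' : α → HelixState (HelixSym Λ Γ) ⊕ ℕ}
    (hq : Primrec fun a => stateNum e (q a)) (hq' : Primrec fun a => stateNum e (q' a))
    (t : HelixTest (HelixSym Λ Γ)) (u : HelixUpdate) :
    Primrec fun a => transCode σ e (q a) t u (q' a) :=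
  TransitionCode.primrec_mk hq (.const _) hq' (.const _) (.const _) (.const _)

theorem primrec_transCodes : Primrec (P.transCodes σ e) := by
  have h2 : Primrec fun n : ℕ => 2 * n := Primrec.nat_mul.comp (.const 2) .id
  have hadd {α : Type} [Primcodable α] {f : α → ℕ} (hf : Primrec f) : Primrec fun a => M + f a :=
    Primrec.nat_add.comp (.const M) hf
  refine Primrec.list_append.comp (.const _) (Primrec.list_cons.comp ?_ (Primrec.list_cons.comp
    (.const _) (Primrec.list_append.comp ?_ ?_)))
  · exact primrec_transCode σ e (.const _) (hadd h2) _ _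
  · refine Primrec.list_map (Primrec.list_range.comp h2) ?_
    exact primrec_transCode σ e (hadd (Primrec.succ.comp .snd)) (hadd .snd) _ _
  · refine Primrec.list_map Primrec.list_range ?_
    exact primrec_transCode σ e (hadd (Primrec.succ.comp (h2.comp .snd))) (.const _) _ _

theorem primrec_code : Primrec (P.code σ e) :=
  RAQCode.primrec_mk (Primrec.nat_add.comp (.const M) (Primrec.nat_mul.comp (.const 2) .id))
    (.const _) (.const _) (.const _) (.const _) (.const _) (P.primrec_transCodes σ e) (.const _)

theorem singleValued_code (n : ℕ) : (P.code σ e n).toRAQ.SingleValued := by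
  intro w r hr r' hr'
  rw [((P.mem_outputs_code_iff σ e n w r).1 hr).1, ((P.mem_outputs_code_iff σ e n w r').1 hr').1]

/-- If the machine does not halt, every word is accepted. -/
theorem outputs_code_of_not_halts {n : ℕ} (h : ¬ P.Halts n) (w : List ℚ) :
    (P.code σ e n).toRAQ.outputs w = {0} := by
  ext r
  rw [mem_outputs_code_iff, Set.mem_singleton_iff, and_iff_left]
  by_contra hw
  obtain ⟨s, hs⟩ := exists_isHelix_of_not_accepts (letter_injective σ) hw
  exact h hs.halts

/-- If the machine halts, a word that encodes its history is not accepted, but becomes accepted when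
its first two letters, a key and a border, are interchanged. -/
theorem exists_perm_of_halts {n : ℕ} (h : P.Halts n) : ∃ w w' : List ℚ, w'.Perm w ∧
    (P.code σ e n).toRAQ.outputs w = ∅ ∧ (P.code σ e n).toRAQ.outputs w' = {0} := by
  -- The keys are chosen so large that they do not stand for symbols.
  obtain ⟨N, k, s, H⟩ := h.exists_isHelix m
  have hN : 0 < N := by
    obtain ⟨i, hi, -⟩ := H.halting
    omega
  let x : ℕ → ℚ := fun p => if p % 2 = 0 then ((m + k (p / 2) : ℕ) : ℚ) else letter σ (s (p / 2))
  let L := (List.range (2 * (N - 1))).map fun p => x (p + 2)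
  have hL : L.length + 2 = 2 * N := by simp only [L, List.length_map, List.length_range]; omega
  have hx : ∀ p < 2 * N, (x 0 :: x 1 :: L).getD p 0 = x p := by
    rintro (_ | _ | p) hp
    · rfl
    · rfl
    · have : p < 2 * (N - 1) := by omega
      simp [L, List.getD_eq_getElem?_getD, this]
  refine ⟨x 0 :: x 1 :: L, x 1 :: x 0 :: L, .swap _ _ _, ?_, ?_⟩
  · ext r
    rw [mem_outputs_code_iff, List.length_cons, List.length_cons, hL]
    simp only [Set.mem_empty_iff_false, iff_false, not_and]
    refine fun _ => H.not_accepts (letter_injective σ) (fun i hi => ?_) fun i hi => ?_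
    · rw [hx _ (by omega)]
      simp [x]
    · rw [hx _ (by omega)]
      simp [x, Nat.add_mod, show (2 * i + 1) / 2 = i by omega]
  · ext r
    rw [mem_outputs_code_iff, Set.mem_singleton_iff, and_iff_left]
    by_contra hw
    obtain ⟨d, hd⟩ := exists_sym_of_not_accepts (i := 0) hw (by simp)
    have hd : x 0 = letter σ d := hd
    simp only [x, letter, Nat.zero_mod, if_true, Nat.cast_inj] at hd
    have := (σ d).2
    omega

theorem isCommutative_code_iff (n : ℕ) :
    (P.code σ e n).toRAQ.IsCommutative ↔ ¬ P.Halts n := by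
  constructor
  · intro hc h
    obtain ⟨w, w', hp, hw, hw'⟩ := P.exists_perm_of_halts σ e h
    have := hc w w' hp
    rw [hw, hw'] at this
    exact Set.singleton_ne_empty _ this.symm
  · intro h w w' _
    rw [P.outputs_code_of_not_halts σ e h, P.outputs_code_of_not_halts σ e h]

end UnaryMachine

/-- The description of an automaton with one state, which outputs `0` on every word. -/
def zeroCode : RAQCode := ⟨0, 0, 0, 0, [0], [], [⟨0, .le 0 0, 0, [], [], []⟩], []⟩

theorem outputs_zeroCode (w : List ℚ) : zeroCode.toRAQ.outputs w = {0} := by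
  have hreach (c : RAQConfig (Fin 1) (Fin 0) (Fin 0)) : zeroCode.toRAQ.Reaches w c c := by
    induction w with
    | nil => exact rfl
    | cons d w ih =>
      refine ⟨c, ⟨_, ⟨_, List.mem_singleton.2 rfl, rfl⟩, Subsingleton.elim (α := Fin 1) _ _,
        Subsingleton.elim (α := Fin 1) _ _, ?_, fun i => Fin.elim0 i, ?_⟩, ih⟩
      · exact le_refl _
      · exact funext fun i => Fin.elim0 i
  have hout (q : Fin 1) (y z : Fin 0 → ℚ) : (zeroCode.toRAQ.out q).eval y z = 0 := by
    change (outputOf 0 0 ([], (0, 0))).eval y z = 0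
    simp [RAQOutput.eval, outputOf, RatCode.val, dotProduct]
  ext r
  constructor
  · rintro ⟨c, -, -, rfl⟩
    exact hout _ _ _
  · rintro rfl
    exact ⟨_, hreach _, ⟨0, List.mem_singleton.2 rfl, rfl⟩, (hout _ _ _).symm⟩

theorem UnaryMachine.equivalent_zeroCode_iff {Λ Γ : Type} [Fintype Λ] [Fintype Γ]
    (P : UnaryMachine Λ Γ) {m M : ℕ} (σ : HelixSym Λ Γ ≃ Fin m)
    (e : HelixState (HelixSym Λ Γ) ≃ Fin M) (n : ℕ) :
    (P.code σ e n).toRAQ.Equivalent zeroCode.toRAQ ↔ ¬ P.Halts n := by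
  constructor
  · intro hc h
    obtain ⟨w, -, -, hw, -⟩ := P.exists_perm_of_halts σ e h
    have := hc w
    rw [hw, outputs_zeroCode] at this
    exact Set.singleton_ne_empty _ this.symm
  · intro h w
    rw [P.outputs_code_of_not_halts σ e h, outputs_zeroCode]

/-- A many-one reduction to a decidable problem decides its source, provided that it only takes
values in the instances of the problem. -/
theorem DecidableProblem.computablePred_comp {α : Type} [Primcodable α] {I P : α → Prop}
    (h : DecidableProblem I P) {f : ℕ → α} (hf : Computable f) (hI : ∀ n, I (f n)) :
    ComputablePred fun n => P (f n) := by
  obtain ⟨g, hg, hgI⟩ := h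
  choose b hb hb' using fun n => hgI (f n) (hI n)
  have hcomp : Computable b := (hg.comp hf).of_eq fun n => Part.eq_some_iff.2 (hb n)
  exact ComputablePred.computable_iff.2 ⟨b, hcomp, funext fun n => propext (hb' n).symm⟩

theorem mainTheorem7 :
    (¬ DecidableProblem (fun c : RAQCode => c.toRAQ.SingleValued)
        (fun c : RAQCode => c.toRAQ.IsCommutative)) ∧
      (¬ DecidableProblem
        (fun p : RAQCode × RAQCode => p.1.toRAQ.SingleValued ∧ p.2.toRAQ.SingleValued)
        (fun p : RAQCode × RAQCode => p.1.toRAQ.Equivalent p.2.toRAQ)) := by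
  obtain ⟨Λ, Γ, _, _, prog, start, blank, a₀, a₁, b, hP⟩ :=
    exists_machine_not_computablePred_haltsOn
  let P : UnaryMachine Λ Γ := ⟨prog, start, blank, a₀, a₁, b⟩
  have σ := Fintype.equivFin (HelixSym Λ Γ)
  have e := Fintype.equivFin (HelixState (HelixSym Λ Γ))
  have hcode : Computable (P.code σ e) := (P.primrec_code σ e).to_comp
  have hnot : ¬ ComputablePred fun n => ¬ P.Halts n := fun h =>
    hP (h.not.of_eq fun n => not_not)
  refine ⟨fun h => hnot ?_, fun h => hnot ?_⟩
  · exact (h.computablePred_comp hcode (P.singleValued_code σ e)).of_eq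
      (P.isCommutative_code_iff σ e)
  · refine (h.computablePred_comp (hcode.pair (Computable.const zeroCode)) fun n =>
      ⟨P.singleValued_code σ e n, fun w => ?_⟩).of_eq (P.equivalent_zeroCode_iff σ e)
    rw [outputs_zeroCode]
    exact Set.subsingleton_singleton
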